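/- Updates are generated at the times $t_0<t_1<\cdots$ of a Poisson process of rate $\lambda>0$ on $[0,\infty)$. The service times $S_0,S_1,\dots$ are i.i.d. copies of a random variable $S\ge 0$ with an arbitrary distribution, and are independent of the arrivals. In the M/G/1/1 queue with preemption, which is empty at time $0$, the service of update $k$ starts at its generation time $t_k$, and update $k$ is discarded if update $k+1$ is generated before that service ends. Thus update $k$ is successfully received, at time $t'_k=t_k+S_k$, if and only if $t_k+S_k<t_{k+1}$. Let $I_0<I_1<\cdots$ be the indices of the successfully received updates, and let $N_\tau$ be the number of $i$ with $t_{I_i}\le\tau$. Put $T_i=t'_{I_i}-t_{I_i}$ (system time), $Y_i=t'_{I_{i+1}}-t'_{I_i}$ (interdeparture time) and $$Q_i=\tfrac12(T_i+Y_i)^2-\tfrac12T_{i+1}^2 .$$ The instantaneous age is $\Delta(t)=t-u(t)$, where $u(t)$ is the generation time of the last update that was successfully received by time $t$; before the first reception $u(t)=-a_0$, where $a_0\ge 0$ is an arbitrary (possibly random) finite initial age. Let $P_\lambda=\mathbb E[e^{-\lambda S}]$ be the Laplace transform of the service time at $\lambda$. Then, almost surely, the limit $\lambda_e=\lim_{\tau\to\infty}N_\tau/\tau$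 exists and equals $\lambda P_\lambda$; each $Q_i$ is integrable, and $\mathbb E(Q_i)=\mathbb E(Q)$ does not depend on $i$. Moreover, almost surely, $\Delta(\cdot)$ is integrable on $[0,\tau]$ for every $\tau\ge0$, and the average age $\Delta=\lim_{\tau\to\infty}\frac1\tau\int_0^\tau\Delta(t)\,dt$ exists and is given by $$\Delta=\lambda_e\,\mathbb E(Q)=\frac{1}{\lambda P_\lambda}.$$ -/

import Mathlib

open MeasureTheory ProbabilityTheory Filter Topology

noncomputable section

namespace MG11

variable {Ω : Type*}

/-- The primitive data of an M/G/1/1 queue, on a probability space `(Ω, P)`. Updates are numbered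
`0, 1, 2, …`. `X 0` is the generation time of update `0`, and `X (k + 1)` is the interarrival time
between updates `k` and `k + 1`; these are i.i.d. exponential of rate `lam` (Poisson arrivals).
`S k` is the service time of update `k`; these are i.i.d. with an arbitrary law `ν` on `[0, ∞)`,
and independent of the interarrival times. -/
structure IsInput [MeasurableSpace Ω] (P : Measure Ω) (lam : ℝ) (ν : Measure ℝ)
    (X S : ℕ → Ω → ℝ) : Prop where
  rate_pos : 0 < lam
  service_nonneg : ν (Set.Iio 0) = 0
  measurable_interarrival : ∀ k, Measurable (X k)
  measurable_service : ∀ k, Measurable (S k)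
  law_interarrival : ∀ k, P.map (X k) = expMeasure lam
  law_service : ∀ k, P.map (S k) = ν
  indep : iIndepFun (Sum.elim X S) P

/-- Laplace transform `∫ exp (-s x) ν(dx)` of the service time law. -/
def laplace (ν : Measure ℝ) (s : ℝ) : ℝ := ∫ x, Real.exp (-(s * x)) ∂ν

/-- Generation (arrival) time `t_k` of update `k`. -/
def genTime (X : ℕ → Ω → ℝ) (k : ℕ) (ω : Ω) : ℝ := ∑ j ∈ Finset.range (k + 1), X j ω

/-- With preemption, the service of update `k` starts at its generation time `t_k`, and (unless it
is preempted) it ends at time `t'_k = t_k + S_k`. -/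
def departTime (X S : ℕ → Ω → ℝ) (k : ℕ) (ω : Ω) : ℝ := genTime X k ω + S k ω

/-- Update `k` is successfully received: its service ends before the generation of the next
update, which would preempt it. -/
def Successful (X S : ℕ → Ω → ℝ) (ω : Ω) (k : ℕ) : Prop :=
  departTime X S k ω < genTime X (k + 1) ω

/-- The generation time `u(t)` of the most recent update that the monitor has received by time
`t`; the update known to the monitor at time `0` has age `a₀`. -/
def lastGen (X S : ℕ → Ω → ℝ) (a₀ : Ω → ℝ) (ω : Ω) (t : ℝ) : ℝ :=
  sSup (insert (-a₀ ω)
    {u | ∃ k, Successful X S ω k ∧ departTime X S k ω ≤ t ∧ u = genTime X k ω})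

/-- The instantaneous age `Δ(t) = t - u(t)`. -/
def age (X S : ℕ → Ω → ℝ) (a₀ : Ω → ℝ) (ω : Ω) (t : ℝ) : ℝ := t - lastGen X S a₀ ω t

/-- The true index `I_i` of the `i`-th successfully received update (`i = 0, 1, 2, …`). -/
def successIndex (X S : ℕ → Ω → ℝ) (i : ℕ) (ω : Ω) : ℕ := Nat.nth (Successful X S ω) i

/-- `N_τ`, the number of successfully received updates generated in `[0, τ]`. -/
def numSuccess (X S : ℕ → Ω → ℝ) (τ : ℝ) (ω : Ω) : ℕ :=
  Set.ncard {k | Successful X S ω k ∧ genTime X k ω ≤ τ}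

/-- The system time `T_i = t'_{I_i} - t_{I_i}` of the `i`-th successfully received update. -/
def systemTime (X S : ℕ → Ω → ℝ) (i : ℕ) (ω : Ω) : ℝ :=
  departTime X S (successIndex X S i ω) ω - genTime X (successIndex X S i ω) ω

/-- The interdeparture time `Y_i = t'_{I_{i+1}} - t'_{I_i}`. -/
def interdeparture (X S : ℕ → Ω → ℝ) (i : ℕ) (ω : Ω) : ℝ :=
  departTime X S (successIndex X S (i + 1) ω) ω - departTime X S (successIndex X S i ω) ω

/-- The area of the trapezoid under the age curve between the lines of slope one that start on
the time axis at `t_{I_i}` and at `t_{I_{i+1}}`. -/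
def trapezoidArea (X S : ℕ → Ω → ℝ) (i : ℕ) (ω : Ω) : ℝ :=
  (systemTime X S i ω + interdeparture X S i ω) ^ 2 / 2 - systemTime X S (i + 1) ω ^ 2 / 2

end MG11

end

/-! The time axis is cut at all arrivals, not only at the successful ones. Write `p = laplace ν
lam`. Update `k` succeeds iff its mark `(X (k+1), S k)` has its second entry below its first. The
marks are i.i.d., and mark `k` is independent of everything before it (`IsInput.indepFun_mark`). The
exponential tail gives success probability `p`, so the law of large numbers, divided by the mean
interarrival time `1/lam`, yields the success rate `lam * p`.

Let `V k` (`genAge`) be the time at arrival `k` since the last successful generation. It satisfies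
`V (k+1) = X (k+1) + V k * fail k`. The age area between arrivals `k` and `k+1` is exactly `X
(k+1)^2 / 2 + V k * min (X (k+1)) (S k)` (`integral_age_interarrival`). The `V k` are dependent, but
`V k` times a centred function of mark `k` is an orthogonal sequence with bounded second moments, so
its averages vanish (`ae_tendsto_average_of_orthogonal`). Hence the minimum may be replaced by its
mean `(1-p)/lam`. Summing the recursion shows that `V` has average `1/(lam*p)`. The area per arrival
is therefore `1/lam^2 + (1-p)/(lam^2*p) = 1/(lam^2*p)`, and dividing by `1/lam` gives the average
age.

For the mean trapezoid, let `K` be the index of success `i+1`. Then `T_i + Y_i = V K + S K` and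
`T_{i+1} = S K`, so `Q_i = V K^2 / 2 + V K * S K`. Expanding over the possible values of `K` gives
series whose terms obey affine recursions with ratio `1-p`; these sum in closed form
(`hasSum_of_affine_recursion`) to `1/(lam*p)^2`. No moment of `S` is needed: `S` enters only through
`min X S` or on the event `S < X`. -/

namespace MG11

/-! ### Affine recursions, series of integrals, and a strong law for orthogonal sequences -/

section Generic

variable {Ω : Type*} [MeasurableSpace Ω] {P : Measure Ω}

/-- Sum of a nonnegative sequence that satisfies an affine recursion with summable forcing. -/
lemma hasSum_of_affine_recursion {a b : ℕ → ℝ} {q B : ℝ} (hq1 : q < 1)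
    (ha : ∀ k, 0 ≤ a k) (hb : ∀ k, 0 ≤ b k) (hrec : ∀ k, a (k + 1) = q * a k + b k)
    (hB : HasSum b B) : HasSum a ((a 0 + B) / (1 - q)) := by
  -- Summability comes first: the recursion gives `(1-q) * ∑_{k<n} a k ≤ a 0 + B`. Only then may the
  -- tsum be solved from `A = a 0 + q*A + B`.
  have h1q : 0 < 1 - q := by linarith
  have hs : Summable a := by
    refine summable_of_sum_range_le (c := (a 0 + B) / (1 - q)) ha fun n => ?_
    have h1 : ∑ k ∈ Finset.range (n + 1), a k
        = q * ∑ k ∈ Finset.range n, a k + ∑ k ∈ Finset.range n, b k + a 0 := by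
      rw [Finset.sum_range_succ', Finset.mul_sum, ← Finset.sum_add_distrib]
      simp [hrec]
    have h2 : ∑ k ∈ Finset.range n, b k ≤ B := sum_le_hasSum _ (fun k _ => hb k) hB
    rw [Finset.sum_range_succ] at h1
    rw [le_div_iff₀ h1q]
    nlinarith [ha n]
  have h1 : ∑' k, a k = a 0 + (q * ∑' k, a k + B) := by
    conv_lhs => rw [hs.tsum_eq_zero_add]
    simp_rw [hrec]
    rw [(hs.mul_left q).tsum_add hB.summable, tsum_mul_left, hB.tsum_eq]
  convert hs.hasSum using 1
  rw [div_eq_iff h1q.ne']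
  linarith

/-- Termwise integration of a series of nonnegative functions. -/
lemma integral_eq_of_hasSum_of_nonneg {f : ℕ → Ω → ℝ} {g : Ω → ℝ} {A : ℝ}
    (hf : ∀ k, Integrable (f k) P) (hf0 : ∀ k, 0 ≤ᵐ[P] f k)
    (hA : HasSum (fun k => ∫ ω, f k ω ∂P) A) (hg : ∀ᵐ ω ∂P, HasSum (fun k => f k ω) (g ω)) :
    Integrable g P ∧ ∫ ω, g ω ∂P = A := by
  have hf0' : ∀ᵐ ω ∂P, ∀ k, 0 ≤ f k ω := ae_all_iff.2 hf0
  have hgm : AEStronglyMeasurable g P := by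
    refine aestronglyMeasurable_of_tendsto_ae atTop
      (f := fun n ω => ∑ k ∈ Finset.range n, f k ω) (fun n => ?_) ?_
    · exact (integrable_finsetSum _ fun k _ => hf k).aestronglyMeasurable
    · filter_upwards [hg] with ω hω using hω.tendsto_sum_nat
  have hg0 : 0 ≤ᵐ[P] g := by
    filter_upwards [hg, hf0'] with ω h1 h2 using h1.nonneg h2
  have hA0 : 0 ≤ A := hA.nonneg fun k => integral_nonneg_of_ae (hf0 k)
  have key : ∫⁻ ω, ENNReal.ofReal (g ω) ∂P = ENNReal.ofReal A := by
    have h1 : ∫⁻ ω, ENNReal.ofReal (g ω) ∂P = ∫⁻ ω, ∑' k, ENNReal.ofReal (f k ω) ∂P := by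
      refine lintegral_congr_ae ?_
      filter_upwards [hg, hf0'] with ω h1 h2
      rw [← h1.tsum_eq, ENNReal.ofReal_tsum_of_nonneg h2 h1.summable]
    rw [h1, lintegral_tsum fun k => (hf k).aestronglyMeasurable.aemeasurable.ennreal_ofReal,
      ← hA.tsum_eq, ENNReal.ofReal_tsum_of_nonneg (fun k => integral_nonneg_of_ae (hf0 k))
        hA.summable]
    exact tsum_congr fun k => (ofReal_integral_eq_lintegral_ofReal (hf k) (hf0 k)).symm
  refine ⟨⟨hgm, ?_⟩, ?_⟩
  · rw [hasFiniteIntegral_iff_ofReal hg0, key]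
    exact ENNReal.ofReal_lt_top
  · rw [integral_eq_lintegral_of_nonneg_ae hg0 hgm, key, ENNReal.toReal_ofReal hA0]

/-- Nonnegative functions whose integrals are summable tend to zero almost everywhere. -/
lemma ae_tendsto_zero_of_summable_integral {f : ℕ → Ω → ℝ} (hf : ∀ k, Integrable (f k) P)
    (hf0 : ∀ k ω, 0 ≤ f k ω) (hs : Summable fun k => ∫ ω, f k ω ∂P) :
    ∀ᵐ ω ∂P, Tendsto (fun k => f k ω) atTop (𝓝 0) := by
  have hm : ∀ k, AEMeasurable (fun ω => ENNReal.ofReal (f k ω)) P :=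
    fun k => (hf k).aestronglyMeasurable.aemeasurable.ennreal_ofReal
  have h1 : ∫⁻ ω, ∑' k, ENNReal.ofReal (f k ω) ∂P ≠ ⊤ := by
    rw [lintegral_tsum hm]
    have h2 : ∀ k, ∫⁻ ω, ENNReal.ofReal (f k ω) ∂P = ENNReal.ofReal (∫ ω, f k ω ∂P) :=
      fun k => (ofReal_integral_eq_lintegral_ofReal (hf k) (.of_forall (hf0 k))).symm
    simp_rw [h2]
    rw [← ENNReal.ofReal_tsum_of_nonneg (fun k => integral_nonneg (hf0 k)) hs]
    exact ENNReal.ofReal_ne_top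
  filter_upwards [ae_lt_top' (AEMeasurable.tsum hm) h1] with ω hω
  have h3 := ENNReal.tendsto_atTop_zero_of_tsum_ne_top hω.ne
  have h4 := (ENNReal.tendsto_toReal (by simp : (0 : ENNReal) ≠ ⊤)).comp h3
  refine h4.congr fun k => ?_
  simp [ENNReal.toReal_ofReal (hf0 k ω)]

/-- If the integrals of `f k ^ 2` are bounded, then `f k / k → 0` almost everywhere. -/
lemma ae_tendsto_div_of_integral_sq_le {f : ℕ → Ω → ℝ} {C : ℝ}
    (hf : ∀ k, Integrable (fun ω => f k ω ^ 2) P) (hC : ∀ k, ∫ ω, f k ω ^ 2 ∂P ≤ C) :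
    ∀ᵐ ω ∂P, Tendsto (fun k : ℕ => f k ω / k) atTop (𝓝 0) := by
  -- The integrals of `(f k / k)^2` are at most `C / k^2`, hence summable; the term `k = 0` is `0`
  -- because division by zero gives `0`.
  have h := ae_tendsto_zero_of_summable_integral (P := P) (f := fun k ω => f k ω ^ 2 / (k : ℝ) ^ 2)
    (fun k => (hf k).div_const _) (fun k ω => by positivity) ?_
  · filter_upwards [h] with ω hω
    simp_rw [← div_pow] at hω
    have := hω.sqrt
    simp only [Real.sqrt_sq_eq_abs, Real.sqrt_zero] at this
    exact (tendsto_zero_iff_abs_tendsto_zero _).2 this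
  · refine Summable.of_nonneg_of_le (fun k => integral_nonneg fun ω => by positivity) (fun k => ?_)
      ((Real.summable_one_div_nat_pow.2 one_lt_two).mul_left C)
    rw [integral_div, mul_one_div]
    gcongr
    exact hC k

/-- Strong law of large numbers for orthogonal functions with bounded second moments. -/
lemma ae_tendsto_average_of_orthogonal {f : ℕ → Ω → ℝ} {C : ℝ} (hf : ∀ k, MemLp (f k) 2 P)
    (hC : ∀ k, ∫ ω, f k ω ^ 2 ∂P ≤ C) (horth : ∀ j k, j < k → ∫ ω, f j ω * f k ω ∂P = 0) :
    ∀ᵐ ω ∂P, Tendsto (fun n : ℕ => (∑ k ∈ Finset.range n, f k ω) / n) atTop (𝓝 0) := by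
  have hmul : ∀ j k, Integrable (fun ω => f j ω * f k ω) P := fun j k => (hf j).integrable_mul (hf k)
  have hsq : ∀ k, Integrable (fun ω => f k ω ^ 2) P := fun k => (hf k).integrable_sq
  have hC0 : 0 ≤ C := (integral_nonneg fun ω => sq_nonneg _).trans (hC 0)
  have hT : ∀ n, MemLp (fun ω => ∑ k ∈ Finset.range n, f k ω) 2 P :=
    fun n => memLp_finsetSum _ fun k _ => hf k
  -- Pythagoras: the cross terms vanish by orthogonality.
  have hTC : ∀ n : ℕ, ∫ ω, (∑ k ∈ Finset.range n, f k ω) ^ 2 ∂P ≤ n * C := by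
    intro n
    induction n with
    | zero => simp
    | succ n ih =>
      have h1 : ∀ ω, (∑ k ∈ Finset.range (n + 1), f k ω) ^ 2
          = (∑ k ∈ Finset.range n, f k ω) ^ 2
            + (2 * (∑ k ∈ Finset.range n, f k ω * f n ω) + f n ω ^ 2) := by
        intro ω
        rw [Finset.sum_range_succ, ← Finset.sum_mul]
        ring
      have hi : Integrable (fun ω => ∑ k ∈ Finset.range n, f k ω * f n ω) P :=
        integrable_finsetSum _ fun k _ => hmul k n
      simp_rw [h1]
      have h2 : Integrable
          (fun ω => 2 * (∑ k ∈ Finset.range n, f k ω * f n ω) + f n ω ^ 2) P :=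
        (hi.const_mul 2).add (hsq n)
      rw [integral_add (hT n).integrable_sq h2,
        integral_add (hi.const_mul 2) (hsq n), integral_const_mul,
        integral_finsetSum _ fun k _ => hmul k n,
        Finset.sum_eq_zero fun k hk => horth k n (Finset.mem_range.1 hk)]
      push_cast
      linarith [hC n]
  have habs : ∀ k, MemLp (fun ω => |f k ω|) 2 P := fun k => (hf k).abs
  -- Along the squares the normalised second moment is at most `n^2 * C / n^4`, which is summable.
  have hA := ae_tendsto_zero_of_summable_integral (P := P)
    (f := fun n ω => ((∑ k ∈ Finset.range (n ^ 2), f k ω) / (n : ℝ) ^ 2) ^ 2) ?_ ?_ ?_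
  -- Between consecutive squares the fluctuation is bounded by a sum of `2n+1` absolute values. By
  -- Cauchy–Schwarz its second moment is at most `(2n+1)^2 * C ≤ 9 * C * n^2`, again summable after
  -- division by `n^4`.
  have hB := ae_tendsto_zero_of_summable_integral (P := P)
    (f := fun n ω => ((∑ k ∈ Finset.Ico (n ^ 2) ((n + 1) ^ 2), |f k ω|) / (n : ℝ) ^ 2) ^ 2) ?_ ?_ ?_
  · filter_upwards [hA, hB] with ω h1 h2
    have h3 := h1.sqrt.add h2.sqrt
    simp only [Real.sqrt_sq_eq_abs, Real.sqrt_zero, add_zero] at h3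
    have hsqrt : Tendsto Nat.sqrt atTop atTop := by
      refine tendsto_atTop_atTop.2 fun b => ⟨b ^ 2, fun a ha => ?_⟩
      rw [Nat.le_sqrt']
      exact ha
    refine squeeze_zero_norm' ?_ (h3.comp hsqrt)
    filter_upwards [eventually_ge_atTop 1] with N hN
    set n := Nat.sqrt N with hn
    have hn1 : 0 < n := Nat.sqrt_pos.2 hN
    have hle : n ^ 2 ≤ N := Nat.sqrt_le' N
    have hlt : N < (n + 1) ^ 2 := Nat.lt_succ_sqrt' N
    have hn1' : (0 : ℝ) < (n : ℝ) ^ 2 := by positivity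
    simp only [Function.comp_apply, ← hn, abs_div, Real.norm_eq_abs, Nat.abs_cast, abs_pow]
    rw [← add_div]
    have h4 : |∑ k ∈ Finset.range N, f k ω| ≤ |∑ k ∈ Finset.range (n ^ 2), f k ω|
        + |(∑ k ∈ Finset.Ico (n ^ 2) ((n + 1) ^ 2), |f k ω|)| := by
      rw [← Finset.sum_range_add_sum_Ico _ hle]
      refine (abs_add_le _ _).trans (add_le_add le_rfl ?_)
      refine (Finset.abs_sum_le_sum_abs (fun k => f k ω) _).trans (le_trans ?_ (le_abs_self _))
      exact Finset.sum_le_sum_of_subset_of_nonneg (Finset.Ico_subset_Ico le_rfl hlt.le)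
        fun _ _ _ => abs_nonneg _
    have h5 : ((n : ℝ) ^ 2) ≤ N := by exact_mod_cast hle
    exact div_le_div₀ (by positivity) h4 hn1' h5
  · intro n
    simp_rw [div_pow]
    exact (memLp_finsetSum _ fun k _ => habs k).integrable_sq.div_const _
  · intro n ω; positivity
  · refine Summable.of_nonneg_of_le (fun k => integral_nonneg fun ω => by positivity) (fun n => ?_)
      ((Real.summable_one_div_nat_pow.2 one_lt_two).mul_left (9 * C))
    simp_rw [div_pow]
    rw [integral_div]
    have h1 : ∫ ω, (∑ k ∈ Finset.Ico (n ^ 2) ((n + 1) ^ 2), |f k ω|) ^ 2 ∂P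
        ≤ (2 * n + 1) ^ 2 * C := by
      have hcard : ((Finset.Ico (n ^ 2) ((n + 1) ^ 2)).card : ℝ) = 2 * n + 1 := by
        rw [Nat.card_Ico, Nat.cast_sub (Nat.pow_le_pow_left n.le_succ 2)]
        push_cast
        ring
      calc ∫ ω, (∑ k ∈ Finset.Ico (n ^ 2) ((n + 1) ^ 2), |f k ω|) ^ 2 ∂P
          ≤ ∫ ω, (2 * n + 1) * ∑ k ∈ Finset.Ico (n ^ 2) ((n + 1) ^ 2), f k ω ^ 2 ∂P := by
            refine integral_mono (memLp_finsetSum _ fun k _ => habs k).integrable_sq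
              ((integrable_finsetSum _ fun k _ => hsq k).const_mul _) fun ω => ?_
            have := sq_sum_le_card_mul_sum_sq (s := Finset.Ico (n ^ 2) ((n + 1) ^ 2))
              (f := fun k => |f k ω|)
            simpa only [hcard, sq_abs] using this
        _ ≤ (2 * n + 1) ^ 2 * C := by
            rw [integral_const_mul, integral_finsetSum _ fun k _ => hsq k, sq (2 * (n : ℝ) + 1),
              mul_assoc]
            gcongr
            refine (Finset.sum_le_card_nsmul _ _ C fun k _ => hC k).trans_eq ?_
            rw [nsmul_eq_mul, hcard]
    rcases Nat.eq_zero_or_pos n with rfl | hn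
    · simp
    · have hn1 : (1 : ℝ) ≤ n := by exact_mod_cast hn
      rw [mul_one_div, div_le_div_iff₀ (by positivity) (by positivity)]
      have h2 : ((2 * n + 1) ^ 2 * C : ℝ) ≤ 9 * C * n ^ 2 := by
        have : ((2 * n + 1) ^ 2 : ℝ) ≤ 9 * n ^ 2 := by nlinarith
        nlinarith
      have h3 := mul_le_mul_of_nonneg_right (h1.trans h2) (sq_nonneg (n : ℝ))
      linarith [h3]
  · intro n
    simp_rw [div_pow]
    exact (hT _).integrable_sq.div_const _
  · intro n ω; positivity
  · refine Summable.of_nonneg_of_le (fun k => integral_nonneg fun ω => by positivity) (fun n => ?_)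
      ((Real.summable_one_div_nat_pow.2 one_lt_two).mul_left C)
    simp_rw [div_pow]
    rw [integral_div]
    have h1 := hTC (n ^ 2)
    rcases Nat.eq_zero_or_pos n with rfl | hn
    · simp
    · have hn1 : (0 : ℝ) < n := by exact_mod_cast hn
      rw [mul_one_div, div_le_div_iff₀ (by positivity) (by positivity)]
      push_cast at h1
      have h3 := mul_le_mul_of_nonneg_right h1 (sq_nonneg (n : ℝ))
      linarith [h3]

end Generic

/-! ### Integrals against the exponential law -/

section Exponential

open Set

variable {r : ℝ}

lemma expMeasure_eq_withDensity (r : ℝ) :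
    expMeasure r = (volume.restrict (Ioi 0)).withDensity
      (fun x => ENNReal.ofReal (r * Real.exp (-(r * x)))) := by
  rw [← Measure.restrict_congr_set Ioi_ae_eq_Ici.symm, ← withDensity_indicator measurableSet_Ici]
  change volume.withDensity (exponentialPDF r) = _
  congr 1
  ext x
  by_cases hx : 0 ≤ x
  · simp [exponentialPDF_eq, hx]
  · simp [exponentialPDF_eq, hx]

lemma integral_expMeasure (hr : 0 < r) (f : ℝ → ℝ) :
    ∫ x, f x ∂expMeasure r = ∫ x in Ioi 0, r * Real.exp (-(r * x)) * f x := by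
  rw [expMeasure_eq_withDensity, integral_withDensity_eq_integral_toReal_smul (by fun_prop)
    (.of_forall fun _ => ENNReal.ofReal_lt_top)]
  refine integral_congr_ae (.of_forall fun x => ?_)
  simp only [smul_eq_mul]
  rw [ENNReal.toReal_ofReal (by positivity)]

lemma integrable_expMeasure_iff (hr : 0 < r) {f : ℝ → ℝ} :
    Integrable f (expMeasure r)
      ↔ IntegrableOn (fun x => r * Real.exp (-(r * x)) * f x) (Ioi 0) := by
  rw [expMeasure_eq_withDensity, integrable_withDensity_iff_integrable_smul' (by fun_prop)
    (.of_forall fun _ => ENNReal.ofReal_lt_top), IntegrableOn]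
  refine integrable_congr (.of_forall fun x => ?_)
  simp only [smul_eq_mul]
  rw [ENNReal.toReal_ofReal (by positivity)]

lemma ae_pos_expMeasure (r : ℝ) : ∀ᵐ x ∂expMeasure r, 0 < x := by
  rw [expMeasure_eq_withDensity]
  exact (withDensity_absolutelyContinuous _ _).ae_le (ae_restrict_mem measurableSet_Ioi)

lemma integrable_pow_expMeasure (hr : 0 < r) (n : ℕ) :
    Integrable (fun x => x ^ n) (expMeasure r) := by
  rw [integrable_expMeasure_iff hr]
  have h := (integrableOn_rpow_mul_exp_neg_mul_rpow (p := 1) (s := n) (b := r)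
    (by linarith [n.cast_nonneg (α := ℝ)]) one_pos hr).const_mul r
  refine h.congr (.of_forall fun x => ?_)
  simp only [Real.rpow_natCast, Real.rpow_one, neg_mul]
  ring

lemma integral_pow_expMeasure (hr : 0 < r) (n : ℕ) :
    ∫ x, x ^ n ∂expMeasure r = n.factorial / r ^ n := by
  rw [integral_expMeasure hr]
  have h := Real.integral_rpow_mul_exp_neg_mul_Ioi (a := n + 1) (by positivity) hr
  rw [Real.Gamma_nat_eq_factorial] at h
  have h2 : ∀ x : ℝ, r * Real.exp (-(r * x)) * x ^ n
      = r * (x ^ ((n : ℝ) + 1 - 1) * Real.exp (-(r * x))) := by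
    intro x
    rw [add_sub_cancel_right, Real.rpow_natCast]
    ring
  simp_rw [h2]
  rw [integral_const_mul, h]
  rw [show ((n : ℝ) + 1) = ((n + 1 : ℕ) : ℝ) by push_cast; ring, Real.rpow_natCast, one_div,
    inv_pow, pow_succ]
  field_simp

lemma integral_Ioi_expPDF (hr : 0 < r) (s : ℝ) :
    ∫ x in Ioi s, r * Real.exp (-(r * x)) = Real.exp (-(r * s)) := by
  have h := integral_exp_mul_Ioi (a := -r) (by linarith) s
  simp only [neg_mul] at h
  rw [integral_const_mul, h]
  field_simp

/-- Tail of the exponential law. -/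
lemma integral_tail_expMeasure (hr : 0 < r) {s : ℝ} (hs : 0 ≤ s) :
    ∫ x, (if s < x then 1 else 0 : ℝ) ∂expMeasure r = Real.exp (-(r * s)) := by
  rw [integral_expMeasure hr, ← integral_Ioi_expPDF hr s]
  have h : ∀ x, r * Real.exp (-(r * x)) * (if s < x then 1 else 0 : ℝ)
      = (Ioi s).indicator (fun x => r * Real.exp (-(r * x))) x := by
    intro x
    simp [Set.indicator_apply]
  simp_rw [h]
  rw [setIntegral_indicator measurableSet_Ioi, Ioi_inter_Ioi, sup_eq_right.2 hs]

/-- Mean of an exponential variable truncated at `s`. -/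
lemma integral_min_expMeasure (hr : 0 < r) {s : ℝ} (hs : 0 ≤ s) :
    ∫ x, min x s ∂expMeasure r = (1 - Real.exp (-(r * s))) / r := by
  have hint : IntegrableOn (fun x => r * Real.exp (-(r * x)) * min x s) (Ioi 0) := by
    have := isProbabilityMeasure_expMeasure hr
    rw [← integrable_expMeasure_iff hr]
    have h1 := integrable_pow_expMeasure hr 1
    simp only [pow_one] at h1
    exact h1.inf (integrable_const s)
  rw [integral_expMeasure hr, ← Ioc_union_Ioi_eq_Ioi hs,
    setIntegral_union (Ioc_disjoint_Ioi le_rfl) measurableSet_Ioi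
      (hint.mono_set Ioc_subset_Ioi_self) (hint.mono_set (Ioi_subset_Ioi hs))]
  have h1 : ∫ x in Ioc 0 s, r * Real.exp (-(r * x)) * min x s
      = 1 / r - (s + 1 / r) * Real.exp (-(r * s)) := by
    rw [setIntegral_congr_fun (g := fun x => r * Real.exp (-(r * x)) * x) measurableSet_Ioc
      (fun x hx => by simp [min_eq_left hx.2]), ← intervalIntegral.integral_of_le hs,
      intervalIntegral.integral_eq_sub_of_hasDerivAt
        (f := fun x => -((x + 1 / r) * Real.exp (-(r * x))))]
    · simp only [mul_zero, neg_zero, Real.exp_zero]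
      ring
    · intro x _
      have h2 : HasDerivAt (fun x => Real.exp (-(r * x))) (Real.exp (-(r * x)) * (-(r * 1))) x :=
        ((hasDerivAt_id x).const_mul r).neg.exp
      convert! (((hasDerivAt_id x).add_const (1 / r)).mul h2).neg using 1
      simp only [id_eq]
      field_simp
      ring
    · exact Continuous.intervalIntegrable (by fun_prop) _ _
  have h2 : ∫ x in Ioi s, r * Real.exp (-(r * x)) * min x s = Real.exp (-(r * s)) * s := by
    rw [setIntegral_congr_fun (g := fun x => r * Real.exp (-(r * x)) * s) measurableSet_Ioi
      (fun x hx => by simp [min_eq_right (le_of_lt (mem_Ioi.1 hx))]), integral_mul_const,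
      integral_Ioi_expPDF hr]
  rw [h1, h2]
  field_simp
  ring

end Exponential

/-! ### Moments of one mark (interarrival time, service time) -/

section ServiceInterarrival

/-- Indicator that a service time is shorter than an interarrival time; the argument is the pair
(interarrival time, service time). -/
noncomputable def succInd (x : ℝ × ℝ) : ℝ := if x.2 < x.1 then 1 else 0

lemma measurable_succInd : Measurable succInd :=
  Measurable.ite (measurableSet_lt measurable_snd measurable_fst) measurable_const measurable_const

lemma succInd_nonneg (x : ℝ × ℝ) : 0 ≤ succInd x := by
  unfold succInd; split_ifs <;> norm_num

lemma succInd_le_one (x : ℝ × ℝ) : succInd x ≤ 1 := by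
  unfold succInd; split_ifs <;> norm_num

lemma min_eq_succInd (x : ℝ × ℝ) : min x.1 x.2 = x.1 * (1 - succInd x) + x.2 * succInd x := by
  unfold succInd
  split_ifs with h
  · simp [min_eq_right h.le]
  · simp [min_eq_left (not_lt.1 h)]

lemma ae_nonneg_of_service {ν : Measure ℝ} (hν : ν (Set.Iio 0) = 0) : ∀ᵐ s ∂ν, 0 ≤ s := by
  rw [ae_iff]
  convert hν using 2
  ext x
  simp

variable {lam : ℝ} {ν : Measure ℝ}

lemma ae_nonneg_prod [SFinite ν] (hν : ν (Set.Iio 0) = 0) (hlam : 0 < lam) :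
    ∀ᵐ x ∂(expMeasure lam).prod ν, 0 < x.1 ∧ 0 ≤ x.2 := by
  have := isProbabilityMeasure_expMeasure hlam
  have h1 : ∀ᵐ x ∂(expMeasure lam).prod ν, 0 < x.1 :=
    Measure.quasiMeasurePreserving_fst.ae (ae_pos_expMeasure lam)
  exact h1.and (Measure.quasiMeasurePreserving_snd.ae (ae_nonneg_of_service hν))

variable [IsProbabilityMeasure ν]

lemma integrable_fst_pow (hlam : 0 < lam) (n : ℕ) :
    Integrable (fun x : ℝ × ℝ => x.1 ^ n) ((expMeasure lam).prod ν) := by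
  have := isProbabilityMeasure_expMeasure hlam
  exact (integrable_pow_expMeasure hlam n).comp_fst ν

lemma integral_fst_pow (hlam : 0 < lam) (n : ℕ) :
    ∫ x, x.1 ^ n ∂(expMeasure lam).prod ν = n.factorial / lam ^ n := by
  have := isProbabilityMeasure_expMeasure hlam
  rw [integral_fun_fst (fun z : ℝ => z ^ n), integral_pow_expMeasure hlam]
  simp

lemma memLp_fst (hlam : 0 < lam) :
    MemLp (fun x : ℝ × ℝ => x.1) 2 ((expMeasure lam).prod ν) :=
  (memLp_two_iff_integrable_sq (by fun_prop)).2 (integrable_fst_pow hlam 2)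

lemma integrable_mul_of_bounded {f g : ℝ × ℝ → ℝ} {π : Measure (ℝ × ℝ)} (hf : Integrable f π)
    (hg : Measurable g) (hg0 : ∀ x, 0 ≤ g x) (hg1 : ∀ x, g x ≤ 1) :
    Integrable (fun x => f x * g x) π :=
  hf.mul_bdd (c := 1) hg.aestronglyMeasurable
    (.of_forall fun x => by rw [Real.norm_eq_abs, abs_of_nonneg (hg0 x)]; exact hg1 x)

lemma integrable_succInd (hlam : 0 < lam) :
    Integrable succInd ((expMeasure lam).prod ν) := by
  have := isProbabilityMeasure_expMeasure hlam
  simpa using integrable_mul_of_bounded (π := (expMeasure lam).prod ν) (integrable_const (1 : ℝ))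
    measurable_succInd succInd_nonneg succInd_le_one

/-- The success probability is the Laplace transform of the service time. -/
lemma integral_succInd (hν : ν (Set.Iio 0) = 0) (hlam : 0 < lam) :
    ∫ x, succInd x ∂(expMeasure lam).prod ν = laplace ν lam := by
  have := isProbabilityMeasure_expMeasure hlam
  rw [integral_prod_symm _ (integrable_succInd hlam)]
  refine integral_congr_ae ?_
  filter_upwards [ae_nonneg_of_service hν] with s hs
  exact integral_tail_expMeasure hlam hs

/-- Domination by the exponential coordinate; the service law may have no finite moments. -/
lemma memLp_min (hν : ν (Set.Iio 0) = 0) (hlam : 0 < lam) :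
    MemLp (fun x : ℝ × ℝ => min x.1 x.2) 2 ((expMeasure lam).prod ν) := by
  refine (memLp_fst hlam).of_le (by fun_prop) ?_
  filter_upwards [ae_nonneg_prod hν hlam] with x hx
  rw [Real.norm_of_nonneg (le_min hx.1.le hx.2), Real.norm_of_nonneg hx.1.le]
  exact min_le_left _ _

lemma integrable_min (hν : ν (Set.Iio 0) = 0) (hlam : 0 < lam) :
    Integrable (fun x : ℝ × ℝ => min x.1 x.2) ((expMeasure lam).prod ν) := by
  have := isProbabilityMeasure_expMeasure hlam
  exact (memLp_min hν hlam).integrable one_le_two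

lemma integrable_exp_neg_mul_service (hν : ν (Set.Iio 0) = 0) (hlam : 0 ≤ lam) :
    Integrable (fun s => Real.exp (-(lam * s))) ν := by
  refine Integrable.of_bound (by fun_prop) 1 ?_
  filter_upwards [ae_nonneg_of_service hν] with s hs
  rw [Real.norm_of_nonneg (Real.exp_pos _).le, Real.exp_le_one_iff]
  have := mul_nonneg hlam hs
  linarith

lemma integral_min (hν : ν (Set.Iio 0) = 0) (hlam : 0 < lam) :
    ∫ x, min x.1 x.2 ∂(expMeasure lam).prod ν = (1 - laplace ν lam) / lam := by
  have := isProbabilityMeasure_expMeasure hlam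
  rw [integral_prod_symm _ (integrable_min hν hlam)]
  have h : ∀ᵐ s ∂ν, ∫ x, min x s ∂expMeasure lam = (1 - Real.exp (-(lam * s))) / lam := by
    filter_upwards [ae_nonneg_of_service hν] with s hs
    exact integral_min_expMeasure hlam hs
  have hi := integrable_exp_neg_mul_service hν hlam.le
  rw [integral_congr_ae h, integral_div, integral_sub (integrable_const _) hi]
  simp [laplace]

lemma laplace_pos (hν : ν (Set.Iio 0) = 0) (hlam : 0 < lam) : 0 < laplace ν lam := by
  have hi := integrable_exp_neg_mul_service hν hlam.le
  exact integral_exp_pos hi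

lemma laplace_le_one (hν : ν (Set.Iio 0) = 0) (hlam : 0 < lam) : laplace ν lam ≤ 1 := by
  have := isProbabilityMeasure_expMeasure hlam
  rw [← integral_succInd hν hlam]
  refine (integral_mono (integrable_succInd hlam) (integrable_const 1) succInd_le_one).trans ?_
  simp

lemma measurable_fail : Measurable fun x : ℝ × ℝ => 1 - succInd x :=
  measurable_const.sub measurable_succInd

lemma integrable_fail (hlam : 0 < lam) :
    Integrable (fun x : ℝ × ℝ => 1 - succInd x) ((expMeasure lam).prod ν) := by
  have := isProbabilityMeasure_expMeasure hlam
  exact (integrable_const 1).sub (integrable_succInd hlam)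

lemma integral_fail (hν : ν (Set.Iio 0) = 0) (hlam : 0 < lam) :
    ∫ x, (1 - succInd x) ∂(expMeasure lam).prod ν = 1 - laplace ν lam := by
  have := isProbabilityMeasure_expMeasure hlam
  rw [integral_sub (integrable_const 1) (integrable_succInd hlam), integral_succInd hν hlam]
  simp

lemma integrable_fst_pow_mul_fail (hlam : 0 < lam) (n : ℕ) :
    Integrable (fun x : ℝ × ℝ => x.1 ^ n * (1 - succInd x)) ((expMeasure lam).prod ν) :=
  integrable_mul_of_bounded (integrable_fst_pow hlam n) measurable_fail
    (fun x => by linarith [succInd_le_one x]) (fun x => by linarith [succInd_nonneg x])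

lemma integrable_fst_pow_mul_succ (hlam : 0 < lam) (n : ℕ) :
    Integrable (fun x : ℝ × ℝ => x.1 ^ n * succInd x) ((expMeasure lam).prod ν) :=
  integrable_mul_of_bounded (integrable_fst_pow hlam n) measurable_succInd succInd_nonneg
    succInd_le_one

lemma measurable_fst_pow_mul_fail (n : ℕ) :
    Measurable fun x : ℝ × ℝ => x.1 ^ n * (1 - succInd x) :=
  (measurable_fst.pow_const n).mul measurable_fail

lemma measurable_fst_pow_mul_succ (n : ℕ) : Measurable fun x : ℝ × ℝ => x.1 ^ n * succInd x :=
  (measurable_fst.pow_const n).mul measurable_succInd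

/-- The separate moments on failure and on success depend on `ν` beyond its transform at `lam`.
Their sum does not depend on `ν`. -/
lemma integral_fst_pow_fail_add_succ (hlam : 0 < lam) (n : ℕ) :
    ∫ x, x.1 ^ n * (1 - succInd x) ∂(expMeasure lam).prod ν
      + ∫ x, x.1 ^ n * succInd x ∂(expMeasure lam).prod ν = n.factorial / lam ^ n := by
  rw [← integral_add (integrable_fst_pow_mul_fail hlam n) (integrable_fst_pow_mul_succ hlam n),
    ← integral_fst_pow (ν := ν) hlam]
  refine integral_congr_ae (.of_forall fun x => ?_)
  simp only
  ring

lemma integral_fst_pow_mul_fail_nonneg (hν : ν (Set.Iio 0) = 0) (hlam : 0 < lam) (n : ℕ) :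
    0 ≤ ∫ x, x.1 ^ n * (1 - succInd x) ∂(expMeasure lam).prod ν := by
  refine integral_nonneg_of_ae ?_
  filter_upwards [ae_nonneg_prod hν hlam] with x hx
  exact mul_nonneg (pow_nonneg hx.1.le n) (by linarith [succInd_le_one x])

lemma integral_fst_pow_mul_succ_nonneg (hν : ν (Set.Iio 0) = 0) (hlam : 0 < lam) (n : ℕ) :
    0 ≤ ∫ x, x.1 ^ n * succInd x ∂(expMeasure lam).prod ν := by
  refine integral_nonneg_of_ae ?_
  filter_upwards [ae_nonneg_prod hν hlam] with x hx
  exact mul_nonneg (pow_nonneg hx.1.le n) (succInd_nonneg x)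

/-- On success the service time equals the minimum, so the product is a difference of two integrable
functions. -/
lemma integrable_snd_mul_succ (hν : ν (Set.Iio 0) = 0) (hlam : 0 < lam) :
    Integrable (fun x : ℝ × ℝ => x.2 * succInd x) ((expMeasure lam).prod ν) := by
  refine ((integrable_min hν hlam).sub (integrable_fst_pow_mul_fail hlam 1)).congr
    (.of_forall fun x => ?_)
  simp only [Pi.sub_apply, min_eq_succInd, pow_one]
  ring

/-- The integrands add up to the minimum. This is what removes the two individual constants from the
mean trapezoid area. -/
lemma integral_fst_fail_add_snd_succ (hν : ν (Set.Iio 0) = 0) (hlam : 0 < lam) :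
    ∫ x, x.1 ^ 1 * (1 - succInd x) ∂(expMeasure lam).prod ν
      + ∫ x, x.2 * succInd x ∂(expMeasure lam).prod ν = (1 - laplace ν lam) / lam := by
  rw [← integral_add (integrable_fst_pow_mul_fail hlam 1) (integrable_snd_mul_succ hν hlam),
    ← integral_min hν hlam]
  refine integral_congr_ae (.of_forall fun x => ?_)
  simp only [min_eq_succInd, pow_one]

end ServiceInterarrival

/-! ### From limits along arrivals to limits in continuous time -/

section Sandwich

lemma tendsto_shift_div {u : ℕ → ℝ} {c : ℝ}
    (hu : Tendsto (fun n : ℕ => u n / n) atTop (𝓝 c)) :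
    Tendsto (fun n : ℕ => u (n + 1) / n) atTop (𝓝 c) := by
  have h1 := (tendsto_add_atTop_iff_nat 1).2 hu
  have h2 : Tendsto (fun n : ℕ => 1 + 1 / (n : ℝ)) atTop (𝓝 (1 + 0)) :=
    tendsto_const_nhds.add tendsto_one_div_atTop_nhds_zero_nat
  have h3 := h1.mul h2
  rw [add_zero, mul_one] at h3
  refine h3.congr' ?_
  filter_upwards [eventually_gt_atTop 0] with n hn
  have : (0 : ℝ) < n := by exact_mod_cast hn
  push_cast
  field_simp

/-- The growth rate of a monotone function is determined by its values along a sequence of linear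
growth. -/
lemma tendsto_div_of_tendsto_along {t : ℕ → ℝ} {f : ℝ → ℝ} {a c : ℝ} (ht0 : 0 < t 0)
    (ht : Monotone t) (ha : 0 < a) (hta : Tendsto (fun n : ℕ => t n / n) atTop (𝓝 a))
    (hf : MonotoneOn f (Set.Ici 0)) (hf0 : 0 ≤ f 0)
    (hfc : Tendsto (fun n : ℕ => f (t n) / n) atTop (𝓝 c)) :
    Tendsto (fun τ => f τ / τ) atTop (𝓝 (c / a)) := by
  have htpos : ∀ n, 0 < t n := fun n => ht0.trans_le (ht n.zero_le)
  have htop : Tendsto t atTop atTop := by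
    refine (hta.pos_mul_atTop ha tendsto_natCast_atTop_atTop).congr' ?_
    filter_upwards [eventually_gt_atTop 0] with n hn
    have : (0 : ℝ) < n := by exact_mod_cast hn
    field_simp
  -- Placing `t 0 ≤ τ` under the quantifier lets `choose` return an index for every `τ`.
  have hex : ∀ τ, ∃ n, t 0 ≤ τ → t n ≤ τ ∧ τ < t (n + 1) := by
    intro τ
    obtain ⟨m, hm⟩ := (htop.eventually_gt_atTop τ).exists
    by_contra! hcon
    have h0 : t 0 ≤ τ := (hcon 0).1
    have : ∀ n, t n ≤ τ := by
      intro n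
      induction n with
      | zero => exact h0
      | succ n ih => exact (hcon n).2 ih
    exact absurd (this m) (not_le.2 hm)
  choose N hN using hex
  have hNtop : Tendsto N atTop atTop := by
    refine tendsto_atTop.2 fun b => ?_
    filter_upwards [eventually_ge_atTop (t b), eventually_ge_atTop (t 0)] with τ h1 h2
    by_contra! hlt
    exact absurd (ht (Nat.succ_le_of_lt hlt)) (not_le.2 (h1.trans_lt (hN τ h2).2))
  -- For `t n ≤ τ < t (n+1)`, the ratio `f τ / τ` lies between `f (t n) / t (n+1)` and `f (t (n+1))
  -- / t n`; the index shift costs nothing in the limit.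
  have hlow : Tendsto (fun n : ℕ => f (t n) / t (n + 1)) atTop (𝓝 (c / a)) := by
    refine (hfc.div (tendsto_shift_div hta) ha.ne').congr' ?_
    filter_upwards [eventually_gt_atTop 0] with n hn
    have : (0 : ℝ) < n := by exact_mod_cast hn
    have := htpos (n + 1)
    simp only [Pi.div_apply]
    field_simp
  have hup : Tendsto (fun n : ℕ => f (t (n + 1)) / t n) atTop (𝓝 (c / a)) := by
    refine ((tendsto_shift_div (u := fun n => f (t n)) hfc).div hta ha.ne').congr' ?_
    filter_upwards [eventually_gt_atTop 0] with n hn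
    have : (0 : ℝ) < n := by exact_mod_cast hn
    have := htpos n
    simp only [Pi.div_apply]
    field_simp
  refine tendsto_of_tendsto_of_tendsto_of_le_of_le' (hlow.comp hNtop) (hup.comp hNtop) ?_ ?_
  · filter_upwards [eventually_ge_atTop (t 0)] with τ h2
    obtain ⟨h3, h4⟩ := hN τ h2
    have hτ : 0 < τ := ht0.trans_le h2
    have hle : f (t (N τ)) ≤ f τ := hf (htpos _).le hτ.le h3
    have h0 : 0 ≤ f τ := hf0.trans (hf (Set.mem_Ici.2 le_rfl) hτ.le hτ.le)
    exact div_le_div₀ h0 hle hτ h4.le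
  · filter_upwards [eventually_ge_atTop (t 0)] with τ h2
    obtain ⟨h3, h4⟩ := hN τ h2
    have hτ : 0 < τ := ht0.trans_le h2
    have hle : f τ ≤ f (t (N τ + 1)) := hf hτ.le (htpos _).le h4.le
    have h0 : 0 ≤ f (t (N τ + 1)) := hf0.trans (hf (Set.mem_Ici.2 le_rfl) (htpos _).le (htpos _).le)
    exact div_le_div₀ h0 hle (htpos _) h3

end Sandwich

/-! ### Pathwise recursions for success counts and generation ages -/

section Path

variable {Ω : Type*} {X S : ℕ → Ω → ℝ} {a₀ : Ω → ℝ} {ω : Ω}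

/-- The interarrival time that follows update `k`, paired with the service time of update `k`. -/
def mark (X S : ℕ → Ω → ℝ) (k : ℕ) (ω : Ω) : ℝ × ℝ := (X (k + 1) ω, S k ω)

open Classical in
/-- The number of successful updates among the first `k`. -/
noncomputable def succCount (X S : ℕ → Ω → ℝ) (k : ℕ) (ω : Ω) : ℕ :=
  Nat.count (Successful X S ω) k

/-- The time elapsed at the generation of update `k` since the generation of the last successful
update before it; `v` is the initial value. -/
noncomputable def genAge (X S : ℕ → Ω → ℝ) (v : ℝ) : ℕ → Ω → ℝ
  | 0, _ => v
  | k + 1, ω => X (k + 1) ω + genAge X S v k ω * (1 - succInd (mark X S k ω))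

lemma genTime_succ (k : ℕ) : genTime X (k + 1) ω = genTime X k ω + X (k + 1) ω := by
  rw [genTime, Finset.sum_range_succ, ← genTime]

lemma genTime_zero : genTime X 0 ω = X 0 ω := by simp [genTime]

lemma successful_iff (k : ℕ) : Successful X S ω k ↔ S k ω < X (k + 1) ω := by
  rw [Successful, departTime, genTime_succ]
  exact add_lt_add_iff_left _

lemma succInd_of_successful {k : ℕ} (h : Successful X S ω k) : succInd (mark X S k ω) = 1 :=
  if_pos ((successful_iff k).1 h)

lemma succInd_of_not_successful {k : ℕ} (h : ¬ Successful X S ω k) :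
    succInd (mark X S k ω) = 0 :=
  if_neg fun h' => h ((successful_iff k).2 h')

lemma succCount_succ_of_successful {k : ℕ} (h : Successful X S ω k) :
    succCount X S (k + 1) ω = succCount X S k ω + 1 := by
  classical
  simp [succCount, Nat.count_succ, h]

lemma succCount_succ_of_not_successful {k : ℕ} (h : ¬ Successful X S ω k) :
    succCount X S (k + 1) ω = succCount X S k ω := by
  classical
  simp [succCount, Nat.count_succ, h]

lemma succCount_eq_sum (n : ℕ) :
    (succCount X S n ω : ℝ) = ∑ k ∈ Finset.range n, succInd (mark X S k ω) := by
  induction n with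
  | zero => simp [succCount]
  | succ n ih =>
    rw [Finset.sum_range_succ, ← ih]
    by_cases h : Successful X S ω n
    · rw [succCount_succ_of_successful h, succInd_of_successful h]
      push_cast
      rfl
    · rw [succCount_succ_of_not_successful h, succInd_of_not_successful h, add_zero]

lemma genTime_strictMono (hx : ∀ k, 0 < X k ω) : StrictMono fun k => genTime X k ω :=
  strictMono_nat_of_lt_succ fun k => by
    rw [genTime_succ]
    exact lt_add_of_pos_right _ (hx _)

lemma genTime_pos (hx : ∀ k, 0 < X k ω) (k : ℕ) : 0 < genTime X k ω :=
  Finset.sum_pos (fun _ _ => hx _) (by simp)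

/-- The shift to `n + 1` arises because update `n`, generated exactly at the cut-off time, is itself
counted. -/
lemma numSuccess_genTime (hx : ∀ k, 0 < X k ω) (n : ℕ) :
    numSuccess X S (genTime X n ω) ω = succCount X S (n + 1) ω := by
  classical
  rw [numSuccess, succCount, Nat.count_eq_card_filter_range, ← Set.ncard_coe_finset]
  congr 1
  ext k
  simp only [Set.mem_ofPred_eq, Finset.coe_filter, Finset.mem_range, Nat.lt_succ_iff,
    (genTime_strictMono hx).le_iff_le]
  exact and_comm

lemma numSuccess_monotone (hx : ∀ k, 0 < X k ω)
    (htop : Tendsto (fun k => genTime X k ω) atTop atTop) :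
    Monotone fun τ => (numSuccess X S τ ω : ℝ) := by
  intro τ₁ τ₂ h
  -- Finiteness is essential: `Set.ncard` of an infinite set is `0`, which would break monotonicity.
  have hfin : {k | Successful X S ω k ∧ genTime X k ω ≤ τ₂}.Finite := by
    obtain ⟨n, hn⟩ := (htop.eventually_gt_atTop τ₂).exists
    refine (Set.finite_lt_nat n).subset fun k hk => ?_
    exact (genTime_strictMono hx).lt_iff_lt.1 (hk.2.trans_lt hn)
  exact Nat.cast_le.2 (Set.ncard_le_ncard (fun k hk => ⟨hk.1, hk.2.trans h⟩) hfin)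

/-- Effect of the initial value on `genAge`: it is forgotten at the first success. -/
lemma genAge_eq_add (v : ℝ) (k : ℕ) :
    genAge X S v k ω = genAge X S 0 k ω + v * (if succCount X S k ω = 0 then 1 else 0) := by
  induction k with
  | zero => simp [genAge, succCount]
  | succ k ih =>
    rw [genAge, genAge, ih]
    by_cases h : Successful X S ω k
    · rw [succCount_succ_of_successful h, succInd_of_successful h]
      simp
    · rw [succCount_succ_of_not_successful h, succInd_of_not_successful h]
      ring

/-- After the first success, `genAge` measures the time since the last successful generation. -/
lemma genAge_eq_sub {i k : ℕ} (h : succCount X S k ω = i + 1) :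
    genAge X S 0 k ω = genTime X k ω - genTime X (successIndex X S i ω) ω := by
  induction k with
  | zero => simp [succCount] at h
  | succ k ih =>
    rw [genAge, genTime_succ]
    by_cases hk : Successful X S ω k
    · rw [succCount_succ_of_successful hk, Nat.add_right_cancel_iff] at h
      have : successIndex X S i ω = k := by
        classical
        rw [successIndex, ← h, succCount]
        exact Nat.nth_count hk
      rw [succInd_of_successful hk, this]
      ring
    · rw [succCount_succ_of_not_successful hk] at h
      rw [succInd_of_not_successful hk, ih h]
      ring

/-- Indicator that exactly `i` of the first `k` updates are successful. -/
noncomputable def countInd (X S : ℕ → Ω → ℝ) (i k : ℕ) (ω : Ω) : ℝ :=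
  if succCount X S k ω = i then 1 else 0

lemma countInd_zero_zero : countInd X S 0 0 ω = 1 := by simp [countInd, succCount]

lemma countInd_succ_zero (i : ℕ) : countInd X S (i + 1) 0 ω = 0 := by simp [countInd, succCount]

lemma countInd_zero_succ (k : ℕ) :
    countInd X S 0 (k + 1) ω = countInd X S 0 k ω * (1 - succInd (mark X S k ω)) := by
  by_cases h : Successful X S ω k
  · simp [countInd, succCount_succ_of_successful h, succInd_of_successful h]
  · simp [countInd, succCount_succ_of_not_successful h, succInd_of_not_successful h]

lemma countInd_succ_succ (i k : ℕ) :
    countInd X S (i + 1) (k + 1) ω = countInd X S (i + 1) k ω * (1 - succInd (mark X S k ω))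
      + countInd X S i k ω * succInd (mark X S k ω) := by
  by_cases h : Successful X S ω k
  · simp [countInd, succCount_succ_of_successful h, succInd_of_successful h]
  · simp [countInd, succCount_succ_of_not_successful h, succInd_of_not_successful h]

lemma countInd_nonneg (i k : ℕ) : 0 ≤ countInd X S i k ω := by
  unfold countInd; split_ifs <;> norm_num

lemma countInd_le_one (i k : ℕ) : countInd X S i k ω ≤ 1 := by
  unfold countInd; split_ifs <;> norm_num

/-- The trapezoid area as a series with one nonzero term. -/
lemma hasSum_trapezoidArea (hinf : {k | Successful X S ω k}.Infinite) (i : ℕ) :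
    HasSum (fun k => countInd X S (i + 1) k ω * succInd (mark X S k ω)
      * (genAge X S 0 k ω ^ 2 / 2 + genAge X S 0 k ω * S k ω)) (trapezoidArea X S i ω) := by
  classical
  set K := successIndex X S (i + 1) ω with hK
  have hKs : Successful X S ω K := Nat.nth_mem_of_infinite hinf _
  have hKc : succCount X S K ω = i + 1 := Nat.count_nth_of_infinite hinf _
  have hval : trapezoidArea X S i ω = countInd X S (i + 1) K ω * succInd (mark X S K ω)
      * (genAge X S 0 K ω ^ 2 / 2 + genAge X S 0 K ω * S K ω) := by
    rw [succInd_of_successful hKs, countInd, if_pos hKc, genAge_eq_sub hKc, trapezoidArea,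
      systemTime, systemTime, interdeparture, ← hK]
    simp only [departTime]
    ring
  rw [hval]
  -- The factors of term `k` require success at `k` with exactly `i + 1` successes before it, which
  -- singles out `K`.
  refine hasSum_single K fun k hk => ?_
  by_cases hs : Successful X S ω k
  · have : succCount X S k ω ≠ i + 1 := by
      intro hc
      apply hk
      rw [hK, successIndex, ← hc, succCount]
      exact (Nat.nth_count hs).symm
    simp [countInd, this]
  · simp [succInd_of_not_successful hs]

lemma genAge_nonneg (hx : ∀ k, 0 < X k ω) {v : ℝ} (hv : 0 ≤ v) (k : ℕ) :
    0 ≤ genAge X S v k ω := by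
  induction k with
  | zero => exact hv
  | succ k ih =>
    rw [genAge]
    have := succInd_le_one (mark X S k ω)
    exact add_nonneg (hx _).le (mul_nonneg ih (by linarith))

/-- The failure indicator is its own square, so the right side is linear in functions of the new
mark, ready for factorisation by independence. -/
lemma genAge_succ_sq (v : ℝ) (k : ℕ) :
    genAge X S v (k + 1) ω ^ 2 = (mark X S k ω).1 ^ 2
      + (genAge X S v k ω * (2 * ((mark X S k ω).1 ^ 1 * (1 - succInd (mark X S k ω))))
        + genAge X S v k ω ^ 2 * (1 - succInd (mark X S k ω))) := by
  rw [genAge]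
  change (_ : ℝ) = X (k + 1) ω ^ 2 + (_ * (2 * (X (k + 1) ω ^ 1 * _)) + _)
  by_cases h : Successful X S ω k
  · rw [succInd_of_successful h]; ring
  · rw [succInd_of_not_successful h]; ring

/-- Sum the recursion after splitting the failure indicator into its mean `1 - p` and a centred
part. Once the last two terms are negligible, the average of `genAge` is the mean interarrival time
divided by `p`. -/
lemma sum_genAge_identity (p : ℝ) (n : ℕ) :
    p * ∑ k ∈ Finset.range n, genAge X S 0 k ω
      = ∑ k ∈ Finset.range n, (mark X S k ω).1 ^ 1
        + ∑ k ∈ Finset.range n, genAge X S 0 k ω * (1 - succInd (mark X S k ω) - (1 - p))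
        - genAge X S 0 n ω := by
  induction n with
  | zero => simp [genAge]
  | succ n ih =>
    rw [Finset.sum_range_succ, Finset.sum_range_succ, Finset.sum_range_succ, mul_add, ih, genAge]
    change _ = _ + X (n + 1) ω ^ 1 + _ - _
    ring

/-- The initial value of `genAge` does not influence long-run averages. -/
lemma tendsto_average_genAge_initial {w : ℕ → ℝ} {c : ℝ} {K : ℕ}
    (hK : succCount X S K ω ≠ 0) (v : ℝ)
    (h : Tendsto (fun n : ℕ => (∑ k ∈ Finset.range n, genAge X S 0 k ω * w k) / n) atTop (𝓝 c)) :
    Tendsto (fun n : ℕ => (∑ k ∈ Finset.range n, genAge X S v k ω * w k) / n) atTop (𝓝 c) := by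
  have hmono : Monotone fun k => succCount X S k ω := by
    classical
    exact Nat.count_monotone _
  -- The correction vanishes from index `K` on, so its sum is eventually constant and disappears
  -- after division by `n`.
  set d : ℕ → ℝ := fun k => v * (if succCount X S k ω = 0 then 1 else 0) * w k with hd
  have h1 := h.add (tendsto_const_div_atTop_nhds_zero_nat (∑ k ∈ Finset.range K, d k))
  rw [add_zero] at h1
  refine h1.congr' ?_
  filter_upwards [eventually_ge_atTop K] with n hn
  have h2 : ∑ k ∈ Finset.range K, d k = ∑ k ∈ Finset.range n, d k := by
    refine Finset.sum_subset (Finset.range_mono hn) fun k _ hk => ?_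
    have : succCount X S k ω ≠ 0 := by
      have := hmono (not_lt.1 fun h => hk (Finset.mem_range.2 h))
      simp only at this
      omega
    simp [hd, this]
  rw [h2, ← add_div, ← Finset.sum_add_distrib]
  congr 1
  refine Finset.sum_congr rfl fun k _ => ?_
  rw [genAge_eq_add v, hd]
  ring

lemma exists_succCount_ne_zero {p : ℝ} (hp : 0 < p)
    (h : Tendsto (fun n : ℕ => (succCount X S n ω : ℝ) / n) atTop (𝓝 p)) :
    ∃ K, succCount X S K ω ≠ 0 := by
  obtain ⟨K, hK⟩ := (h.eventually_ne hp.ne').exists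
  refine ⟨K, fun h0 => hK ?_⟩
  simp [h0]

/-- With finitely many successes the count would be bounded and its rate zero. Infinitude gives
`Nat.nth` its intended meaning at every index. -/
lemma infinite_successful {p : ℝ} (hp : 0 < p)
    (h : Tendsto (fun n : ℕ => (succCount X S n ω : ℝ) / n) atTop (𝓝 p)) :
    {k | Successful X S ω k}.Infinite := by
  classical
  intro hfin
  have hb : ∀ n, (succCount X S n ω : ℝ) ≤ hfin.toFinset.card := by
    intro n
    rw [succCount, Nat.count_eq_card_filter_range]
    refine Nat.cast_le.2 (Finset.card_le_card fun k hk => ?_)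
    simpa using (Finset.mem_filter.1 hk).2
  have h0 : Tendsto (fun n : ℕ => (succCount X S n ω : ℝ) / n) atTop (𝓝 0) :=
    squeeze_zero (fun n => by positivity) (fun n => div_le_div_of_nonneg_right (hb n) n.cast_nonneg)
      (tendsto_const_div_atTop_nhds_zero_nat _)
  exact hp.ne' (tendsto_nhds_unique h h0)

/-- The count reaches `i + 1` either by staying there after a failure, which keeps the old age, or
by a success at `k`, which resets the age to the new interarrival time. -/
lemma countInd_mul_genAge_succ (i k : ℕ) :
    countInd X S (i + 1) (k + 1) ω * genAge X S 0 (k + 1) ω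
      = (countInd X S (i + 1) k ω * ((mark X S k ω).1 ^ 1 * (1 - succInd (mark X S k ω)))
        + countInd X S i k ω * ((mark X S k ω).1 ^ 1 * succInd (mark X S k ω)))
        + countInd X S (i + 1) k ω * genAge X S 0 k ω * (1 - succInd (mark X S k ω)) := by
  rw [countInd_succ_succ, genAge]
  change _ = (_ * (X (k + 1) ω ^ 1 * _) + _ * (X (k + 1) ω ^ 1 * _)) + _
  by_cases h : Successful X S ω k
  · rw [succInd_of_successful h]; ring
  · rw [succInd_of_not_successful h]; ring

lemma countInd_mul_genAge_sq_succ (i k : ℕ) :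
    countInd X S (i + 1) (k + 1) ω * genAge X S 0 (k + 1) ω ^ 2
      = ((countInd X S (i + 1) k ω * ((mark X S k ω).1 ^ 2 * (1 - succInd (mark X S k ω)))
        + countInd X S i k ω * ((mark X S k ω).1 ^ 2 * succInd (mark X S k ω)))
        + countInd X S (i + 1) k ω * genAge X S 0 k ω
          * (2 * ((mark X S k ω).1 ^ 1 * (1 - succInd (mark X S k ω)))))
        + countInd X S (i + 1) k ω * genAge X S 0 k ω ^ 2 * (1 - succInd (mark X S k ω)) := by
  rw [countInd_succ_succ, genAge]
  change _ = ((_ * (X (k + 1) ω ^ 2 * _) + _ * (X (k + 1) ω ^ 2 * _))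
    + _ * (2 * (X (k + 1) ω ^ 1 * _))) + _
  by_cases h : Successful X S ω k
  · rw [succInd_of_successful h]; ring
  · rw [succInd_of_not_successful h]; ring

end Path

/-! ### The age curve and its exact area -/

section Age

variable {Ω : Type*} {X S : ℕ → Ω → ℝ} {a₀ : Ω → ℝ} {ω : Ω}

lemma bddAbove_received (hs : ∀ k, 0 ≤ S k ω) (t : ℝ) :
    BddAbove (insert (-a₀ ω)
      {u | ∃ k, Successful X S ω k ∧ departTime X S k ω ≤ t ∧ u = genTime X k ω}) := by
  refine BddAbove.insert _ ⟨t, ?_⟩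
  rintro u ⟨k, -, hk, rfl⟩
  exact (le_add_of_nonneg_right (hs k)).trans hk

lemma lastGen_monotone (hs : ∀ k, 0 ≤ S k ω) : Monotone (lastGen X S a₀ ω) := by
  intro t₁ t₂ h
  refine csSup_le_csSup (bddAbove_received hs t₂) (Set.insert_nonempty _ _) ?_
  refine Set.insert_subset_insert ?_
  rintro u ⟨k, h1, h2, h3⟩
  exact ⟨k, h1, h2.trans h, h3⟩

lemma intervalIntegrable_age (hs : ∀ k, 0 ≤ S k ω) (a b : ℝ) :
    IntervalIntegrable (age X S a₀ ω) volume a b :=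
  (continuous_id.intervalIntegrable a b).sub (lastGen_monotone hs).intervalIntegrable

lemma age_nonneg (hs : ∀ k, 0 ≤ S k ω) (ha : 0 ≤ a₀ ω) {t : ℝ} (ht : 0 ≤ t) :
    0 ≤ age X S a₀ ω t := by
  refine sub_nonneg.2 (csSup_le (Set.insert_nonempty _ _) ?_)
  rintro u (rfl | ⟨k, -, hk, rfl⟩)
  · linarith
  · exact (le_add_of_nonneg_right (hs k)).trans hk

/-- Generation time of the last successful update before update `k`, or `-a₀` if there is none. -/
noncomputable def prevGen (X S : ℕ → Ω → ℝ) (a₀ : Ω → ℝ) (k : ℕ) (ω : Ω) : ℝ :=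
  genTime X k ω - genAge X S (X 0 ω + a₀ ω) k ω

lemma prevGen_zero : prevGen X S a₀ 0 ω = -a₀ ω := by
  simp [prevGen, genAge, genTime_zero]

lemma prevGen_succ_of_successful {k : ℕ} (h : Successful X S ω k) :
    prevGen X S a₀ (k + 1) ω = genTime X k ω := by
  rw [prevGen, genAge, succInd_of_successful h, genTime_succ]
  ring

lemma prevGen_succ_of_not_successful {k : ℕ} (h : ¬ Successful X S ω k) :
    prevGen X S a₀ (k + 1) ω = prevGen X S a₀ k ω := by
  rw [prevGen, prevGen, genAge, succInd_of_not_successful h, genTime_succ]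
  ring

/-- Links the supremum in `lastGen` to the recursion: generation times increase and exceed `-a₀`, so
each success supplies the new maximum. -/
lemma isGreatest_prevGen (hx : ∀ k, 0 < X k ω) (ha : 0 ≤ a₀ ω) (k : ℕ) :
    IsGreatest (insert (-a₀ ω) {u | ∃ j, Successful X S ω j ∧ j < k ∧ u = genTime X j ω})
      (prevGen X S a₀ k ω) := by
  induction k with
  | zero => simp [prevGen_zero, IsGreatest, upperBounds]
  | succ k ih =>
    by_cases h : Successful X S ω k
    · rw [prevGen_succ_of_successful h]
      refine ⟨Or.inr ⟨k, h, k.lt_succ_self, rfl⟩, ?_⟩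
      rintro u (rfl | ⟨j, -, hj, rfl⟩)
      · linarith [genTime_pos hx k]
      · exact (genTime_strictMono hx).monotone (Nat.lt_succ_iff.1 hj)
    · rw [prevGen_succ_of_not_successful h]
      convert! ih using 2
      ext u
      constructor
      · rintro ⟨j, h1, h2, h3⟩
        refine ⟨j, h1, lt_of_le_of_ne (Nat.lt_succ_iff.1 h2) ?_, h3⟩
        rintro rfl
        exact h h1
      · rintro ⟨j, h1, h2, h3⟩
        exact ⟨j, h1, h2.trans k.lt_succ_self, h3⟩

/-- If exactly the successful updates before `k` have been received by time `t`, then the monitor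
knows the last of them. -/
lemma lastGen_eq_prevGen (hx : ∀ k, 0 < X k ω) (ha : 0 ≤ a₀ ω) {k : ℕ} {t : ℝ}
    (h1 : ∀ j, Successful X S ω j → (departTime X S j ω ≤ t ↔ j < k)) :
    lastGen X S a₀ ω t = prevGen X S a₀ k ω := by
  rw [lastGen, ← (isGreatest_prevGen (S := S) hx ha k).csSup_eq]
  congr 2
  ext u
  exact exists_congr fun j => and_congr_right fun hj => and_congr_left fun _ => h1 j hj

lemma departTime_le_of_successful (hx : ∀ k, 0 < X k ω) {j k : ℕ} (hj : Successful X S ω j)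
    (hjk : j < k) : departTime X S j ω ≤ genTime X k ω :=
  (le_of_lt hj).trans ((genTime_strictMono hx).monotone hjk)

lemma genTime_le_departTime (hx : ∀ k, 0 < X k ω) (hs : ∀ k, 0 ≤ S k ω) {j k : ℕ} (hjk : k ≤ j) :
    genTime X k ω ≤ departTime X S j ω :=
  ((genTime_strictMono hx).monotone hjk).trans (le_add_of_nonneg_right (hs j))

lemma lastGen_of_lt_genTime_zero (hx : ∀ k, 0 < X k ω) (hs : ∀ k, 0 ≤ S k ω) (ha : 0 ≤ a₀ ω)
    {t : ℝ} (ht : t < genTime X 0 ω) : lastGen X S a₀ ω t = -a₀ ω := by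
  rw [← prevGen_zero (X := X) (S := S), lastGen_eq_prevGen hx ha]
  intro j _
  simpa using ht.trans_le (genTime_le_departTime hx hs j.zero_le)

lemma lastGen_before_service_end (hx : ∀ k, 0 < X k ω) (hs : ∀ k, 0 ≤ S k ω) (ha : 0 ≤ a₀ ω)
    {k : ℕ} {t : ℝ} (h1 : genTime X k ω ≤ t)
    (h2 : t < genTime X k ω + min (X (k + 1) ω) (S k ω)) :
    lastGen X S a₀ ω t = prevGen X S a₀ k ω := by
  refine lastGen_eq_prevGen hx ha fun j hj => ⟨fun h => ?_, fun h =>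
    (departTime_le_of_successful hx hj h).trans h1⟩
  by_contra! hkj
  rcases hkj.eq_or_lt with rfl | hkj
  · have := min_le_right (X (k + 1) ω) (S k ω)
    rw [departTime] at h
    linarith
  · have h3 := genTime_le_departTime (S := S) hx hs hkj
    rw [genTime_succ] at h3
    have := min_le_left (X (k + 1) ω) (S k ω)
    linarith

/-- If update `k` is preempted, the minimum is the interarrival time and the time range is empty;
otherwise update `k` has just been received. -/
lemma lastGen_after_service_end (hx : ∀ k, 0 < X k ω) (hs : ∀ k, 0 ≤ S k ω) (ha : 0 ≤ a₀ ω)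
    {k : ℕ} {t : ℝ} (h1 : genTime X k ω + min (X (k + 1) ω) (S k ω) ≤ t)
    (h2 : t < genTime X (k + 1) ω) :
    lastGen X S a₀ ω t = prevGen X S a₀ (k + 1) ω := by
  refine lastGen_eq_prevGen hx ha fun j hj => ⟨fun h => ?_, fun h => ?_⟩
  · by_contra! hkj
    exact absurd (h.trans_lt h2) (not_lt.2 (genTime_le_departTime hx hs hkj))
  · rcases (Nat.lt_succ_iff.1 h).eq_or_lt with rfl | hjk
    · rwa [min_eq_right (le_of_lt ((successful_iff j).1 hj))] at h1
    · have h3 := departTime_le_of_successful hx hj hjk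
      have := le_min (hx (k + 1)).le (hs k)
      linarith

lemma integral_age_of_lastGen_eq {a b c : ℝ} (hab : a ≤ b)
    (h : ∀ t ∈ Set.Ioo a b, lastGen X S a₀ ω t = c) :
    ∫ t in a..b, age X S a₀ ω t = ((b - c) ^ 2 - (a - c) ^ 2) / 2 := by
  rw [intervalIntegral.integral_congr_Ioo_of_le (g := fun t => t - c) hab
    (fun t ht => by simp only [age, h t ht]),
    intervalIntegral.integral_comp_sub_right (fun x => x), integral_id]

/-- Area under the age curve between consecutive arrivals. -/
lemma integral_age_interarrival (hx : ∀ k, 0 < X k ω) (hs : ∀ k, 0 ≤ S k ω) (ha : 0 ≤ a₀ ω)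
    (k : ℕ) : ∫ t in genTime X k ω..genTime X (k + 1) ω, age X S a₀ ω t
      = X (k + 1) ω ^ 2 / 2
        + genAge X S (X 0 ω + a₀ ω) k ω * min (X (k + 1) ω) (S k ω) := by
  have hm0 := le_min (hx (k + 1)).le (hs k)
  have hm1 := min_le_left (X (k + 1) ω) (S k ω)
  rw [← intervalIntegral.integral_add_adjacent_intervals
    (b := genTime X k ω + min (X (k + 1) ω) (S k ω)) (intervalIntegrable_age hs _ _)
    (intervalIntegrable_age hs _ _),
    integral_age_of_lastGen_eq (by linarith) fun t ht =>
      lastGen_before_service_end hx hs ha ht.1.le ht.2,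
    integral_age_of_lastGen_eq (by rw [genTime_succ]; linarith) fun t ht =>
      lastGen_after_service_end hx hs ha ht.1.le ht.2]
  by_cases h : Successful X S ω k
  · rw [prevGen_succ_of_successful h, prevGen, genTime_succ]
    ring
  · rw [min_eq_left (not_lt.1 fun h' => h ((successful_iff k).2 h')),
      prevGen_succ_of_not_successful h, prevGen, genTime_succ]
    ring

lemma integral_age_genTime (hx : ∀ k, 0 < X k ω) (hs : ∀ k, 0 ≤ S k ω) (ha : 0 ≤ a₀ ω) (n : ℕ) :
    ∫ t in (0 : ℝ)..genTime X n ω, age X S a₀ ω t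
      = ((X 0 ω + a₀ ω) ^ 2 - a₀ ω ^ 2) / 2 + ∑ k ∈ Finset.range n, (X (k + 1) ω ^ 2 / 2
        + genAge X S (X 0 ω + a₀ ω) k ω * min (X (k + 1) ω) (S k ω)) := by
  induction n with
  | zero =>
    rw [integral_age_of_lastGen_eq (genTime_pos hx 0).le fun t ht =>
      lastGen_of_lt_genTime_zero hx hs ha ht.2, genTime_zero]
    simp
  | succ n ih =>
    rw [Finset.sum_range_succ, ← add_assoc, ← ih, ← integral_age_interarrival hx hs ha]
    exact (intervalIntegral.integral_add_adjacent_intervals (intervalIntegrable_age hs _ _)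
      (intervalIntegrable_age hs _ _)).symm

lemma integral_age_monotoneOn (hs : ∀ k, 0 ≤ S k ω) (ha : 0 ≤ a₀ ω) :
    MonotoneOn (fun τ => ∫ t in (0 : ℝ)..τ, age X S a₀ ω t) (Set.Ici 0) := by
  intro τ₁ h1 τ₂ _ h
  simp only
  rw [← intervalIntegral.integral_add_adjacent_intervals (intervalIntegrable_age hs 0 τ₁)
    (intervalIntegrable_age hs τ₁ τ₂)]
  exact le_add_of_nonneg_right (intervalIntegral.integral_nonneg h fun t ht =>
    age_nonneg hs ha ((Set.mem_Ici.1 h1).trans ht.1))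

end Age

/-! ### The filtration of the past and adaptedness -/

section History

variable {Ω : Type*} {X S : ℕ → Ω → ℝ}

/-- The σ-algebra generated by `X 0, …, X k` and `S 0, …, S (k - 1)`. -/
abbrev history (X S : ℕ → Ω → ℝ) (k : ℕ) : MeasurableSpace Ω :=
  ⨆ i ∈ {i : ℕ ⊕ ℕ | Sum.elim (· ≤ k) (· < k) i},
    MeasurableSpace.comap (Sum.elim X S i) inferInstance

lemma measurable_history_interarrival {j k : ℕ} (h : j ≤ k) : Measurable[history X S k] (X j) :=
  (comap_measurable (X j)).mono (le_iSup₂_of_le (Sum.inl j) h le_rfl) le_rfl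

lemma measurable_history_service {j k : ℕ} (h : j < k) : Measurable[history X S k] (S j) :=
  (comap_measurable (S j)).mono (le_iSup₂_of_le (Sum.inr j) h le_rfl) le_rfl

lemma measurable_history_mark {j k : ℕ} (h : j < k) : Measurable[history X S k] (mark X S j) :=
  (measurable_history_interarrival h).prodMk (measurable_history_service h)

lemma history_mono : Monotone (history X S) := by
  intro j k hjk
  refine biSup_mono fun i hi => ?_
  rcases i with i | i
  · exact le_trans (α := ℕ) hi hjk
  · exact lt_of_lt_of_le (α := ℕ) hi hjk

lemma measurable_history_succInd {j k : ℕ} (h : j < k) :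
    Measurable[history X S k] fun ω => succInd (mark X S j ω) :=
  measurable_succInd.comp (measurable_history_mark h)

/-- The initial value is a constant here. The random value `X 0 + a₀` enters only pathwise, through
`tendsto_average_genAge_initial`, so `a₀` may depend on the whole future. -/
lemma measurable_history_genAge (v : ℝ) (k : ℕ) : Measurable[history X S k] (genAge X S v k) := by
  induction k with
  | zero => exact measurable_const
  | succ k ih =>
    have h1 := measurable_history_interarrival (X := X) (S := S) (le_refl (k + 1))
    have h2 := measurable_history_succInd (X := X) (S := S) k.lt_succ_self
    exact h1.add ((ih.mono (history_mono k.le_succ) le_rfl).mul (measurable_const.sub h2))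

lemma measurable_history_countInd (i k : ℕ) :
    Measurable[history X S k] (countInd X S i k) := by
  induction k generalizing i with
  | zero =>
    have : countInd X S i 0 = fun _ => if 0 = i then (1 : ℝ) else 0 := by
      ext ω
      simp [countInd, succCount]
    rw [this]
    exact measurable_const
  | succ k ih =>
    have h2 := measurable_history_succInd (X := X) (S := S) k.lt_succ_self
    have h3 := fun i => (ih i).mono (history_mono k.le_succ) le_rfl
    rcases i with _ | i
    · rw [funext fun ω => countInd_zero_succ (X := X) (S := S) (ω := ω) k]
      exact (h3 0).mul (measurable_const.sub h2)
    · rw [funext fun ω => countInd_succ_succ (X := X) (S := S) (ω := ω) i k]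
      exact ((h3 _).mul (measurable_const.sub h2)).add ((h3 _).mul h2)

end History

/-! ### Independence of each mark from its past -/

section Input

variable {Ω : Type*} [MeasurableSpace Ω] {P : Measure Ω} {lam : ℝ} {ν : Measure ℝ}
  {X S : ℕ → Ω → ℝ}

lemma IsInput.measurable_elim (hXS : IsInput P lam ν X S) (i : ℕ ⊕ ℕ) :
    Measurable (Sum.elim X S i) := by
  rcases i with i | i
  · exact hXS.measurable_interarrival i
  · exact hXS.measurable_service i

lemma IsInput.history_le (hXS : IsInput P lam ν X S) (k : ℕ) :
    history X S k ≤ ‹MeasurableSpace Ω› :=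
  iSup₂_le fun i _ => (hXS.measurable_elim i).comap_le

lemma IsInput.measurable_mark (hXS : IsInput P lam ν X S) (k : ℕ) : Measurable (mark X S k) :=
  (hXS.measurable_interarrival _).prodMk (hXS.measurable_service _)

/-- `history X S k` stops at `X k` and `S (k-1)`, while mark `k` uses `X (k+1)` and `S k`: disjoint
blocks of an independent family. -/
lemma IsInput.indepFun_mark (hXS : IsInput P lam ν X S) {β : Type*} [MeasurableSpace β]
    {U : Ω → β} {k : ℕ} (hU : Measurable[history X S k] U) : IndepFun U (mark X S k) P := by
  rw [IndepFun_iff_Indep]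
  have hdisj : Disjoint {i : ℕ ⊕ ℕ | Sum.elim (· ≤ k) (· < k) i} {Sum.inl (k + 1), Sum.inr k} := by
    rw [Set.disjoint_left]
    rintro (i | i) hi hi' <;> simp at hi hi' <;> omega
  have h := indep_iSup_of_disjoint (fun i => (hXS.measurable_elim i).comap_le)
    hXS.indep.iIndep hdisj
  refine indep_of_indep_of_le_right (indep_of_indep_of_le_left h hU.comap_le) ?_
  refine Measurable.comap_le (Measurable.prodMk ?_ ?_)
  · exact (comap_measurable (X (k + 1))).mono
      (le_iSup₂_of_le (Sum.inl (k + 1)) (by simp) le_rfl) le_rfl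
  · exact (comap_measurable (S k)).mono (le_iSup₂_of_le (Sum.inr k) (by simp) le_rfl) le_rfl

lemma IsInput.ae_interarrival_pos (hXS : IsInput P lam ν X S) : ∀ᵐ ω ∂P, ∀ k, 0 < X k ω := by
  refine ae_all_iff.2 fun k => ae_of_ae_map (hXS.measurable_interarrival k).aemeasurable ?_
  rw [hXS.law_interarrival]
  exact ae_pos_expMeasure lam

lemma IsInput.ae_service_nonneg (hXS : IsInput P lam ν X S) : ∀ᵐ ω ∂P, ∀ k, 0 ≤ S k ω := by
  refine ae_all_iff.2 fun k => ae_of_ae_map (hXS.measurable_service k).aemeasurable ?_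
  rw [hXS.law_service]
  exact ae_nonneg_of_service hXS.service_nonneg

variable [IsProbabilityMeasure P]

lemma IsInput.map_mark (hXS : IsInput P lam ν X S) (k : ℕ) :
    P.map (mark X S k) = (expMeasure lam).prod ν := by
  have h : IndepFun (X (k + 1)) (S k) P :=
    hXS.indep.indepFun (i := Sum.inl (k + 1)) (j := Sum.inr k) (by simp)
  rw [← hXS.law_interarrival (k + 1), ← hXS.law_service k]
  exact (indepFun_iff_map_prod_eq_prod_map_map (hXS.measurable_interarrival _).aemeasurable
    (hXS.measurable_service _).aemeasurable).1 h

lemma IsInput.integral_comp_mark (hXS : IsInput P lam ν X S) {f : ℝ × ℝ → ℝ} (hf : Measurable f)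
    (k : ℕ) : ∫ ω, f (mark X S k ω) ∂P = ∫ x, f x ∂(expMeasure lam).prod ν := by
  rw [← hXS.map_mark k, integral_map (hXS.measurable_mark k).aemeasurable hf.aestronglyMeasurable]

lemma IsInput.integrable_comp_mark (hXS : IsInput P lam ν X S) {f : ℝ × ℝ → ℝ}
    (hf : Integrable f ((expMeasure lam).prod ν)) (k : ℕ) :
    Integrable (fun ω => f (mark X S k ω)) P := by
  rw [← hXS.map_mark k] at hf
  exact hf.comp_measurable (hXS.measurable_mark k)

lemma IsInput.integrable_mul_mark (hXS : IsInput P lam ν X S) {U : Ω → ℝ} {k : ℕ}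
    (hU : Measurable[history X S k] U) (hUi : Integrable U P) {f : ℝ × ℝ → ℝ} (hf : Measurable f)
    (hfi : Integrable f ((expMeasure lam).prod ν)) :
    Integrable (fun ω => U ω * f (mark X S k ω)) P :=
  ((hXS.indepFun_mark hU).comp measurable_id hf).integrable_mul hUi
    (hXS.integrable_comp_mark hfi k)

lemma IsInput.integral_mul_mark (hXS : IsInput P lam ν X S) {U : Ω → ℝ} {k : ℕ}
    (hU : Measurable[history X S k] U) {f : ℝ × ℝ → ℝ} (hf : Measurable f) :
    ∫ ω, U ω * f (mark X S k ω) ∂P = (∫ ω, U ω ∂P) * ∫ x, f x ∂(expMeasure lam).prod ν := by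
  rw [← hXS.integral_comp_mark hf k]
  exact ((hXS.indepFun_mark hU).comp measurable_id hf).integral_fun_mul_eq_mul_integral
    (hU.mono (hXS.history_le k) le_rfl).aestronglyMeasurable
    (hf.comp (hXS.measurable_mark k)).aestronglyMeasurable

/-- Strong law of large numbers for functions of the marks. -/
lemma IsInput.ae_tendsto_average_mark (hXS : IsInput P lam ν X S) {f : ℝ × ℝ → ℝ}
    (hf : Measurable f) (hfi : Integrable f ((expMeasure lam).prod ν)) :
    ∀ᵐ ω ∂P, Tendsto (fun n : ℕ => (∑ k ∈ Finset.range n, f (mark X S k ω)) / n) atTop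
      (𝓝 (∫ x, f x ∂(expMeasure lam).prod ν)) := by
  rw [← hXS.integral_comp_mark hf 0]
  refine strong_law_ae_real (fun k ω => f (mark X S k ω)) (hXS.integrable_comp_mark hfi 0) ?_ ?_
  · intro j k hjk
    rcases hjk.lt_or_gt with h | h
    · exact (hXS.indepFun_mark (measurable_history_mark h)).comp hf hf
    · exact ((hXS.indepFun_mark (measurable_history_mark h)).comp hf hf).symm
  · intro k
    refine IdentDistrib.comp (u := f) ⟨(hXS.measurable_mark k).aemeasurable,
      (hXS.measurable_mark 0).aemeasurable, ?_⟩ hf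
    rw [hXS.map_mark, hXS.map_mark]

end Input

/-! ### Moment bounds for the generation age and its weighted strong law -/

section Moments

variable {Ω : Type*} [MeasurableSpace Ω] {P : Measure Ω} {lam : ℝ} {ν : Measure ℝ}
  [IsProbabilityMeasure P] [IsProbabilityMeasure ν] {X S : ℕ → Ω → ℝ}

lemma le_of_affine_recursion {a : ℕ → ℝ} {q B : ℝ} (hq : 0 ≤ q) (hq1 : q < 1)
    (ha0 : a 0 ≤ B / (1 - q)) (hrec : ∀ k, a (k + 1) ≤ q * a k + B) (k : ℕ) :
    a k ≤ B / (1 - q) := by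
  have h1q : 0 < 1 - q := by linarith
  induction k with
  | zero => exact ha0
  | succ k ih =>
    have h1 := mul_le_mul_of_nonneg_left ih hq
    have h2 : q * (B / (1 - q)) + B = B / (1 - q) := by
      field_simp
      ring
    linarith [hrec k]

lemma IsInput.integrable_genAge (hXS : IsInput P lam ν X S) (k : ℕ) :
    Integrable (genAge X S 0 k) P := by
  induction k with
  | zero => exact integrable_const 0
  | succ k ih =>
    have h1 := hXS.integrable_comp_mark (integrable_fst_pow hXS.rate_pos 1) k
    simp only [pow_one] at h1
    exact h1.add (hXS.integrable_mul_mark (measurable_history_genAge 0 k) ih measurable_fail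
      (integrable_fail hXS.rate_pos))

lemma IsInput.integral_genAge_succ (hXS : IsInput P lam ν X S) (k : ℕ) :
    ∫ ω, genAge X S 0 (k + 1) ω ∂P
      = (1 - laplace ν lam) * ∫ ω, genAge X S 0 k ω ∂P + 1 / lam := by
  have h1 := hXS.integrable_comp_mark (integrable_fst_pow hXS.rate_pos 1) k
  have h2 := hXS.integrable_mul_mark (measurable_history_genAge 0 k) (hXS.integrable_genAge k)
    measurable_fail (integrable_fail hXS.rate_pos)
  have h3 := hXS.integral_comp_mark (measurable_fst.pow_const 1) k
  rw [integral_fst_pow hXS.rate_pos] at h3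
  simp only [pow_one, Nat.factorial_one, Nat.cast_one] at h1 h3
  have h4 := hXS.integral_mul_mark (measurable_history_genAge 0 k) measurable_fail
  rw [integral_fail hXS.service_nonneg hXS.rate_pos] at h4
  simp only [genAge]
  refine (integral_add h1 h2).trans ?_
  rw [h3, h4]
  ring

omit [IsProbabilityMeasure P] in
lemma IsInput.laplace_compl_bounds (hXS : IsInput P lam ν X S) :
    0 ≤ 1 - laplace ν lam ∧ 1 - laplace ν lam < 1 :=
  ⟨by linarith [laplace_le_one hXS.service_nonneg hXS.rate_pos],
    by linarith [laplace_pos hXS.service_nonneg hXS.rate_pos]⟩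

lemma IsInput.integral_genAge_le (hXS : IsInput P lam ν X S) (k : ℕ) :
    ∫ ω, genAge X S 0 k ω ∂P ≤ 1 / lam / (1 - (1 - laplace ν lam)) := by
  have h := hXS.laplace_compl_bounds
  have h0 := hXS.rate_pos
  refine le_of_affine_recursion (a := fun k => ∫ ω, genAge X S 0 k ω ∂P) h.1 h.2 ?_
    (fun k => (hXS.integral_genAge_succ k).le) k
  simp only [genAge, integral_zero]
  exact div_nonneg (by positivity) (by linarith)

lemma IsInput.integrable_genAge_sq (hXS : IsInput P lam ν X S) (k : ℕ) :
    Integrable (fun ω => genAge X S 0 k ω ^ 2) P := by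
  induction k with
  | zero => simp [genAge]
  | succ k ih =>
    simp_rw [genAge_succ_sq]
    refine (hXS.integrable_comp_mark (integrable_fst_pow hXS.rate_pos 2) k).add
      ((hXS.integrable_mul_mark (measurable_history_genAge 0 k) (hXS.integrable_genAge k)
        ((measurable_fst_pow_mul_fail 1).const_mul 2)
        ((integrable_fst_pow_mul_fail hXS.rate_pos 1).const_mul 2)).add
      (hXS.integrable_mul_mark ((measurable_history_genAge 0 k).pow_const 2) ih measurable_fail
        (integrable_fail hXS.rate_pos)))

lemma IsInput.integral_genAge_sq_succ (hXS : IsInput P lam ν X S) (k : ℕ) :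
    ∫ ω, genAge X S 0 (k + 1) ω ^ 2 ∂P
      = (1 - laplace ν lam) * ∫ ω, genAge X S 0 k ω ^ 2 ∂P + (2 / lam ^ 2
        + 2 * (∫ x, x.1 ^ 1 * (1 - succInd x) ∂(expMeasure lam).prod ν)
          * ∫ ω, genAge X S 0 k ω ∂P) := by
  have h1 := hXS.integrable_comp_mark (integrable_fst_pow hXS.rate_pos 2) k
  have h2 := hXS.integrable_mul_mark (measurable_history_genAge 0 k) (hXS.integrable_genAge k)
        ((measurable_fst_pow_mul_fail 1).const_mul 2)
        ((integrable_fst_pow_mul_fail hXS.rate_pos 1).const_mul 2)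
  have h3 := hXS.integrable_mul_mark ((measurable_history_genAge 0 k).pow_const 2)
    (hXS.integrable_genAge_sq k) measurable_fail (integrable_fail hXS.rate_pos)
  simp_rw [genAge_succ_sq]
  refine (integral_add h1 (h2.add h3)).trans ?_
  rw [integral_add' h2 h3,
    hXS.integral_comp_mark (measurable_fst.pow_const 2), integral_fst_pow hXS.rate_pos,
    hXS.integral_mul_mark (measurable_history_genAge 0 k)
      ((measurable_fst_pow_mul_fail 1).const_mul 2),
    hXS.integral_mul_mark ((measurable_history_genAge 0 k).pow_const 2) measurable_fail,
    integral_fail hXS.service_nonneg hXS.rate_pos, integral_const_mul]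
  simp only [Nat.factorial]
  push_cast
  ring

lemma IsInput.exists_integral_genAge_sq_le (hXS : IsInput P lam ν X S) :
    ∃ C, ∀ k, ∫ ω, genAge X S 0 k ω ^ 2 ∂P ≤ C := by
  have h := hXS.laplace_compl_bounds
  have h0 := hXS.rate_pos
  have hc := integral_fst_pow_mul_fail_nonneg (ν := ν) hXS.service_nonneg hXS.rate_pos 1
  have hM : 0 ≤ 1 / lam / (1 - (1 - laplace ν lam)) := div_nonneg (by positivity) (by linarith)
  refine ⟨_, le_of_affine_recursion (a := fun k => ∫ ω, genAge X S 0 k ω ^ 2 ∂P)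
    (B := 2 / lam ^ 2 + 2 * (∫ x, x.1 ^ 1 * (1 - succInd x) ∂(expMeasure lam).prod ν)
      * (1 / lam / (1 - (1 - laplace ν lam)))) h.1 h.2 ?_ fun k => ?_⟩
  · simp only [genAge]
    refine le_trans (by simp) (div_nonneg (by positivity) (by linarith))
  · rw [hXS.integral_genAge_sq_succ k]
    gcongr
    exact hXS.integral_genAge_le k

/-- Strong law for `genAge` weighted by centred functions of the marks. -/
lemma IsInput.ae_tendsto_average_genAge_mul_centered (hXS : IsInput P lam ν X S) {f : ℝ × ℝ → ℝ}
    (hf : Measurable f) (hf2 : MemLp f 2 ((expMeasure lam).prod ν)) :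
    ∀ᵐ ω ∂P, Tendsto (fun n : ℕ => (∑ k ∈ Finset.range n, genAge X S 0 k ω
      * (f (mark X S k ω) - ∫ x, f x ∂(expMeasure lam).prod ν)) / n) atTop (𝓝 0) := by
  have := isProbabilityMeasure_expMeasure hXS.rate_pos
  set π := (expMeasure lam).prod ν with hπ
  set g : ℝ × ℝ → ℝ := fun x => f x - ∫ x, f x ∂π with hg
  have hgm : Measurable g := hf.sub measurable_const
  have hg2 : MemLp g 2 π := hf2.sub (memLp_const _)
  have hg0 : ∫ x, g x ∂π = 0 := by
    rw [hg, integral_sub (hf2.integrable one_le_two) (integrable_const _)]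
    simp
  obtain ⟨C, hC⟩ := hXS.exists_integral_genAge_sq_le
  have hV := fun k => measurable_history_genAge (X := X) (S := S) 0 k
  refine ae_tendsto_average_of_orthogonal (f := fun k ω => genAge X S 0 k ω * g (mark X S k ω))
    (C := C * ∫ x, g x ^ 2 ∂π) (fun k => ?_) (fun k => ?_) fun j k hjk => ?_
  · refine (memLp_two_iff_integrable_sq ?_).2 ?_
    · exact (((hV k).mono (hXS.history_le k) le_rfl).mul
        (hgm.comp (hXS.measurable_mark k))).aestronglyMeasurable
    · simp_rw [mul_pow]
      exact hXS.integrable_mul_mark ((hV k).pow_const 2) (hXS.integrable_genAge_sq k)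
        (hgm.pow_const 2) hg2.integrable_sq
  · simp_rw [mul_pow]
    rw [hXS.integral_mul_mark ((hV k).pow_const 2) (hgm.pow_const 2)]
    exact mul_le_mul_of_nonneg_right (hC k) (integral_nonneg fun _ => sq_nonneg _)
  -- For `j < k` every factor except the last is known by arrival `k`, and the last is a centred
  -- function of mark `k`.
  · simp_rw [← mul_assoc]
    rw [hXS.integral_mul_mark (U := fun ω => genAge X S 0 j ω * g (mark X S j ω) * genAge X S 0 k ω)
      ((((hV j).mono (history_mono hjk.le) le_rfl).mul
        (hgm.comp (measurable_history_mark hjk))).mul (hV k)) hgm, hg0, mul_zero]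

end Moments

/-! ### Almost sure long-run averages -/

section LongRun

variable {Ω : Type*} [MeasurableSpace Ω] {P : Measure Ω} {lam : ℝ} {ν : Measure ℝ}
  [IsProbabilityMeasure P] [IsProbabilityMeasure ν] {X S : ℕ → Ω → ℝ}

lemma IsInput.ae_tendsto_genTime_div (hXS : IsInput P lam ν X S) :
    ∀ᵐ ω ∂P, Tendsto (fun n : ℕ => genTime X n ω / n) atTop (𝓝 (1 / lam)) := by
  have h := hXS.ae_tendsto_average_mark (measurable_fst.pow_const 1)
    (integrable_fst_pow hXS.rate_pos 1)
  rw [integral_fst_pow hXS.rate_pos] at h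
  filter_upwards [h] with ω hω
  have h1 := (tendsto_const_div_atTop_nhds_zero_nat (X 0 ω)).add hω
  simp only [pow_one, Nat.factorial_one, Nat.cast_one, zero_add] at h1
  refine h1.congr fun n => ?_
  rw [genTime, Finset.sum_range_succ', add_div, add_comm]
  rfl

lemma IsInput.ae_tendsto_succCount_div (hXS : IsInput P lam ν X S) :
    ∀ᵐ ω ∂P, Tendsto (fun n : ℕ => (succCount X S n ω : ℝ) / n) atTop (𝓝 (laplace ν lam)) := by
  have h := hXS.ae_tendsto_average_mark measurable_succInd (integrable_succInd hXS.rate_pos)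
  rw [integral_succInd hXS.service_nonneg hXS.rate_pos] at h
  simpa only [succCount_eq_sum] using h

lemma IsInput.ae_tendsto_average_genAge (hXS : IsInput P lam ν X S) :
    ∀ᵐ ω ∂P, Tendsto (fun n : ℕ => (∑ k ∈ Finset.range n, genAge X S 0 k ω) / n) atTop
      (𝓝 (1 / lam / laplace ν lam)) := by
  have := isProbabilityMeasure_expMeasure hXS.rate_pos
  have hp := laplace_pos hXS.service_nonneg hXS.rate_pos
  obtain ⟨C, hC⟩ := hXS.exists_integral_genAge_sq_le
  have h1 := hXS.ae_tendsto_average_mark (measurable_fst.pow_const 1)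
    (integrable_fst_pow hXS.rate_pos 1)
  rw [integral_fst_pow hXS.rate_pos] at h1
  have h2 := hXS.ae_tendsto_average_genAge_mul_centered measurable_fail
    (MemLp.of_bound measurable_fail.aestronglyMeasurable 1 (.of_forall fun x => by
      rw [Real.norm_eq_abs, abs_le]
      constructor <;> linarith [succInd_le_one x, succInd_nonneg x]))
  rw [integral_fail hXS.service_nonneg hXS.rate_pos] at h2
  filter_upwards [h1, h2, ae_tendsto_div_of_integral_sq_le hXS.integrable_genAge_sq hC]
    with ω g1 g2 g3
  -- The three limits are those of the right side of `sum_genAge_identity`: `1/lam`, `0` and `0`.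
  have g4 := ((g1.add g2).sub g3).div_const (laplace ν lam)
  simp only [Nat.factorial_one, Nat.cast_one, pow_one, add_zero, sub_zero] at g4
  refine g4.congr fun n => ?_
  have := sum_genAge_identity (X := X) (S := S) (ω := ω) (laplace ν lam) n
  simp only [pow_one] at this
  rw [← add_div, ← sub_div, ← this]
  field_simp

lemma IsInput.ae_tendsto_average_genAge_mul_min (hXS : IsInput P lam ν X S) :
    ∀ᵐ ω ∂P, Tendsto (fun n : ℕ => (∑ k ∈ Finset.range n,
        genAge X S 0 k ω * min (X (k + 1) ω) (S k ω)) / n) atTop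
      (𝓝 (1 / lam / laplace ν lam * ((1 - laplace ν lam) / lam))) := by
  have h := hXS.ae_tendsto_average_genAge_mul_centered (measurable_fst.min measurable_snd)
    (memLp_min hXS.service_nonneg hXS.rate_pos)
  rw [integral_min hXS.service_nonneg hXS.rate_pos] at h
  filter_upwards [h, hXS.ae_tendsto_average_genAge] with ω g1 g2
  -- Add back the mean of the minimum that was subtracted for centring.
  have g3 := g1.add (g2.mul_const ((1 - laplace ν lam) / lam))
  rw [zero_add] at g3
  refine g3.congr fun n => ?_
  rw [div_mul_eq_mul_div, ← add_div, Finset.sum_mul, ← Finset.sum_add_distrib]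
  congr 1
  refine Finset.sum_congr rfl fun k _ => ?_
  rw [mark]
  ring

/-- The rate of successful updates. -/
lemma IsInput.ae_tendsto_numSuccess_div (hXS : IsInput P lam ν X S) :
    ∀ᵐ ω ∂P, Tendsto (fun τ : ℝ => (numSuccess X S τ ω : ℝ) / τ) atTop
      (𝓝 (lam * laplace ν lam)) := by
  have hlam := hXS.rate_pos
  filter_upwards [hXS.ae_interarrival_pos, hXS.ae_tendsto_genTime_div,
    hXS.ae_tendsto_succCount_div] with ω hx ht hc
  have htop : Tendsto (fun k => genTime X k ω) atTop atTop := by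
    refine (ht.pos_mul_atTop (by positivity) tendsto_natCast_atTop_atTop).congr' ?_
    filter_upwards [eventually_gt_atTop 0] with n hn
    have : (0 : ℝ) < n := by exact_mod_cast hn
    field_simp
  have h := tendsto_div_of_tendsto_along (genTime_pos hx 0) (genTime_strictMono hx).monotone
    (by positivity) ht ((numSuccess_monotone (S := S) hx htop).monotoneOn _) (Nat.cast_nonneg _)
    (c := laplace ν lam) (by
      simp_rw [numSuccess_genTime hx]
      exact tendsto_shift_div hc)
  convert h using 2
  field_simp

/-- The average age. -/
lemma IsInput.ae_tendsto_average_age (hXS : IsInput P lam ν X S) {a₀ : Ω → ℝ}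
    (ha₀ : ∀ ω, 0 ≤ a₀ ω) :
    ∀ᵐ ω ∂P, Tendsto (fun τ : ℝ => (1 / τ) * ∫ t in (0 : ℝ)..τ, age X S a₀ ω t) atTop
      (𝓝 (1 / (lam * laplace ν lam))) := by
  have hlam := hXS.rate_pos
  have hp := laplace_pos hXS.service_nonneg hXS.rate_pos
  have hsq := hXS.ae_tendsto_average_mark (measurable_fst.pow_const 2)
    (integrable_fst_pow hXS.rate_pos 2)
  rw [integral_fst_pow hXS.rate_pos] at hsq
  filter_upwards [hXS.ae_interarrival_pos, hXS.ae_service_nonneg, hXS.ae_tendsto_genTime_div,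
    hXS.ae_tendsto_succCount_div, hsq, hXS.ae_tendsto_average_genAge_mul_min]
    with ω hx hs ht hc h1 h2
  obtain ⟨K, hK⟩ := exists_succCount_ne_zero hp hc
  have h3 := tendsto_average_genAge_initial hK (X 0 ω + a₀ ω) h2
  have h4 := ((tendsto_const_div_atTop_nhds_zero_nat
    (((X 0 ω + a₀ ω) ^ 2 - a₀ ω ^ 2) / 2)).add (h1.div_const 2)).add h3
  have h := tendsto_div_of_tendsto_along (genTime_pos hx 0) (genTime_strictMono hx).monotone
    (by positivity) ht (integral_age_monotoneOn (X := X) hs (ha₀ ω)) (by simp)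
    (h4.congr fun n => by
      rw [integral_age_genTime hx hs (ha₀ ω), Finset.sum_add_distrib, ← Finset.sum_div]
      simp only [mark]
      ring)
  have heq : (0 + (Nat.factorial 2 : ℝ) / lam ^ 2 / 2
      + 1 / lam / laplace ν lam * ((1 - laplace ν lam) / lam)) / (1 / lam)
      = 1 / (lam * laplace ν lam) := by
    simp only [Nat.factorial]
    push_cast
    field_simp
    ring
  rw [heq] at h
  simpa only [one_div_mul_eq_div] using h

end LongRun

/-! ### The mean trapezoid area -/

section Trapezoid

variable {Ω : Type*} [MeasurableSpace Ω] {P : Measure Ω} {lam : ℝ} {ν : Measure ℝ}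
  [IsProbabilityMeasure P] [IsProbabilityMeasure ν] {X S : ℕ → Ω → ℝ}

omit [IsProbabilityMeasure P] [IsProbabilityMeasure ν] in
lemma IsInput.measurable_countInd (hXS : IsInput P lam ν X S) (i k : ℕ) :
    Measurable (countInd X S i k) :=
  (measurable_history_countInd i k).mono (hXS.history_le k) le_rfl

omit [IsProbabilityMeasure P] [IsProbabilityMeasure ν] in
lemma IsInput.integrable_countInd_mul (hXS : IsInput P lam ν X S) (i k : ℕ) {U : Ω → ℝ}
    (hU : Integrable U P) : Integrable (fun ω => countInd X S i k ω * U ω) P :=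
  hU.bdd_mul (c := 1) (hXS.measurable_countInd i k).aestronglyMeasurable
    (.of_forall fun ω => by
      rw [Real.norm_of_nonneg (countInd_nonneg i k)]
      exact countInd_le_one i k)

omit [IsProbabilityMeasure ν] in
lemma IsInput.integrable_countInd (hXS : IsInput P lam ν X S) (i k : ℕ) :
    Integrable (countInd X S i k) P := by
  simpa using hXS.integrable_countInd_mul i k (integrable_const (1 : ℝ))

/-- Expected number of updates with exactly `i` successes before them. -/
lemma IsInput.hasSum_integral_countInd (hXS : IsInput P lam ν X S) (i : ℕ) :
    HasSum (fun k => ∫ ω, countInd X S i k ω ∂P) (1 / laplace ν lam) := by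
  have hν := hXS.service_nonneg
  have hlam := hXS.rate_pos
  have hp := laplace_pos hν hlam
  have hq := hXS.laplace_compl_bounds
  have hfail := fun i k => hXS.integrable_mul_mark (measurable_history_countInd i k)
    (hXS.integrable_countInd i k) measurable_fail (integrable_fail hlam)
  have hsucc := fun i k => hXS.integrable_mul_mark (measurable_history_countInd i k)
    (hXS.integrable_countInd i k) measurable_succInd (integrable_succInd hlam)
  have hnn : ∀ i k, 0 ≤ ∫ ω, countInd X S i k ω ∂P :=
    fun i k => integral_nonneg fun ω => countInd_nonneg i k
  induction i with
  | zero =>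
    -- Before the first success there is no forcing, so this is a geometric series starting at `1`.
    -- For `i + 1` the start is `0` and the forcing sums to `p * (1/p) = 1`, giving the same total
    -- `1/p`.
    have h := hasSum_of_affine_recursion (a := fun k => ∫ ω, countInd X S 0 k ω ∂P)
      (b := fun _ => 0) hq.2 (hnn 0) (fun _ => le_rfl) (fun k => ?_) hasSum_zero
    · convert h using 1
      simp [countInd_zero_zero]
    · simp_rw [countInd_zero_succ]
      rw [hXS.integral_mul_mark (measurable_history_countInd 0 k) measurable_fail,
        integral_fail hν hlam]
      ring
  | succ i ih =>
    have h := hasSum_of_affine_recursion (a := fun k => ∫ ω, countInd X S (i + 1) k ω ∂P)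
      (b := fun k => laplace ν lam * ∫ ω, countInd X S i k ω ∂P) hq.2 (hnn _)
      (fun k => mul_nonneg hp.le (hnn _ k)) (fun k => ?_) (ih.mul_left _)
    · convert h using 1
      simp only [countInd_succ_zero, integral_zero, sub_sub_cancel]
      field_simp
      ring
    · simp_rw [countInd_succ_succ]
      rw [integral_add (hfail _ k) (hsucc _ k),
        hXS.integral_mul_mark (measurable_history_countInd _ k) measurable_fail,
        hXS.integral_mul_mark (measurable_history_countInd _ k) measurable_succInd,
        integral_fail hν hlam, integral_succInd hν hlam]
      ring

omit [IsProbabilityMeasure P] [IsProbabilityMeasure ν] in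
lemma IsInput.integral_countInd_mul_genAge_pow_nonneg (hXS : IsInput P lam ν X S) (i k n : ℕ) :
    0 ≤ ∫ ω, countInd X S i k ω * genAge X S 0 k ω ^ n ∂P := by
  refine integral_nonneg_of_ae ?_
  filter_upwards [hXS.ae_interarrival_pos] with ω hω
  exact mul_nonneg (countInd_nonneg i k) (pow_nonneg (genAge_nonneg hω le_rfl k) n)

/-- The forcing sums to `(c + c')/p`, with `c`, `c'` the means of `X` on failure and on success;
since `c + c' = 1/lam`, dividing by `p` gives the value, independent of `i`. -/
lemma IsInput.hasSum_integral_countInd_mul_genAge (hXS : IsInput P lam ν X S) (i : ℕ) :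
    HasSum (fun k => ∫ ω, countInd X S (i + 1) k ω * genAge X S 0 k ω ∂P)
      (1 / (lam * laplace ν lam ^ 2)) := by
  have hν := hXS.service_nonneg
  have hlam := hXS.rate_pos
  have hp := laplace_pos hν hlam
  have hq := hXS.laplace_compl_bounds
  have hcc := integral_fst_pow_fail_add_succ (ν := ν) hlam 1
  set c := ∫ x, x.1 ^ 1 * (1 - succInd x) ∂(expMeasure lam).prod ν with hc
  set c' := ∫ x, x.1 ^ 1 * succInd x ∂(expMeasure lam).prod ν with hc'
  have hc0 : 0 ≤ c := integral_fst_pow_mul_fail_nonneg hν hlam 1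
  have hc0' : 0 ≤ c' := integral_fst_pow_mul_succ_nonneg hν hlam 1
  have hm := fun i k => measurable_history_countInd (X := X) (S := S) i k
  have hmV : ∀ k, Measurable[history X S k]
      fun ω => countInd X S (i + 1) k ω * genAge X S 0 k ω :=
    fun k => (hm (i + 1) k).mul (measurable_history_genAge 0 k)
  have hnn : ∀ i k, 0 ≤ ∫ ω, countInd X S i k ω ∂P :=
    fun i k => integral_nonneg fun ω => countInd_nonneg i k
  have h := hasSum_of_affine_recursion
    (a := fun k => ∫ ω, countInd X S (i + 1) k ω * genAge X S 0 k ω ∂P)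
    (b := fun k => c * ∫ ω, countInd X S (i + 1) k ω ∂P + c' * ∫ ω, countInd X S i k ω ∂P)
    hq.2 (fun k => by simpa using hXS.integral_countInd_mul_genAge_pow_nonneg (i + 1) k 1)
    (fun k => add_nonneg (mul_nonneg hc0 (hnn _ k)) (mul_nonneg hc0' (hnn _ k))) (fun k => ?_)
    (((hXS.hasSum_integral_countInd (i + 1)).mul_left c).add
      ((hXS.hasSum_integral_countInd i).mul_left c'))
  · convert h using 1
    rw [← add_mul, hcc]
    simp only [countInd_succ_zero, zero_mul, integral_zero, sub_sub_cancel,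
      Nat.factorial_one, Nat.cast_one]
    field_simp
    ring
  · have i1 := hXS.integrable_mul_mark (hm (i + 1) k) (hXS.integrable_countInd (i + 1) k)
      (measurable_fst_pow_mul_fail 1) (integrable_fst_pow_mul_fail hlam 1)
    have i2 := hXS.integrable_mul_mark (hm i k) (hXS.integrable_countInd i k)
      (measurable_fst_pow_mul_succ 1) (integrable_fst_pow_mul_succ hlam 1)
    have i3 := hXS.integrable_mul_mark (hmV k)
      (hXS.integrable_countInd_mul (i + 1) k (hXS.integrable_genAge k)) measurable_fail
      (integrable_fail hlam)
    simp_rw [countInd_mul_genAge_succ]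
    refine (integral_add (i1.add i2) i3).trans ?_
    rw [integral_add' i1 i2, hXS.integral_mul_mark (hm (i + 1) k) (measurable_fst_pow_mul_fail 1),
      hXS.integral_mul_mark (hm i k) (measurable_fst_pow_mul_succ 1),
      hXS.integral_mul_mark (hmV k) measurable_fail, integral_fail hν hlam]
    ring

/-- The second moments on failure and success again combine, to `2/lam^2`, but the cross term keeps
the mean of `X` on failure, which cancels only in the trapezoid. -/
lemma IsInput.hasSum_integral_countInd_mul_genAge_sq (hXS : IsInput P lam ν X S) (i : ℕ) :
    HasSum (fun k => ∫ ω, countInd X S (i + 1) k ω * genAge X S 0 k ω ^ 2 ∂P)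
      (2 / (lam ^ 2 * laplace ν lam ^ 2)
        + 2 * (∫ x, x.1 ^ 1 * (1 - succInd x) ∂(expMeasure lam).prod ν)
          / (lam * laplace ν lam ^ 3)) := by
  have hν := hXS.service_nonneg
  have hlam := hXS.rate_pos
  have hp := laplace_pos hν hlam
  have hq := hXS.laplace_compl_bounds
  have hcc := integral_fst_pow_fail_add_succ (ν := ν) hlam 2
  set c := ∫ x, x.1 ^ 1 * (1 - succInd x) ∂(expMeasure lam).prod ν with hc
  set d := ∫ x, x.1 ^ 2 * (1 - succInd x) ∂(expMeasure lam).prod ν with hd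
  set d' := ∫ x, x.1 ^ 2 * succInd x ∂(expMeasure lam).prod ν with hd'
  have hc0 : 0 ≤ c := integral_fst_pow_mul_fail_nonneg hν hlam 1
  have hd0 : 0 ≤ d := integral_fst_pow_mul_fail_nonneg hν hlam 2
  have hd0' : 0 ≤ d' := integral_fst_pow_mul_succ_nonneg hν hlam 2
  have hm := fun i k => measurable_history_countInd (X := X) (S := S) i k
  have hmV : ∀ k, Measurable[history X S k]
      fun ω => countInd X S (i + 1) k ω * genAge X S 0 k ω :=
    fun k => (hm (i + 1) k).mul (measurable_history_genAge 0 k)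
  have hmV2 : ∀ k, Measurable[history X S k]
      fun ω => countInd X S (i + 1) k ω * genAge X S 0 k ω ^ 2 :=
    fun k => (hm (i + 1) k).mul ((measurable_history_genAge 0 k).pow_const 2)
  have hnn : ∀ i k, 0 ≤ ∫ ω, countInd X S i k ω ∂P :=
    fun i k => integral_nonneg fun ω => countInd_nonneg i k
  have hnV : ∀ k, 0 ≤ ∫ ω, countInd X S (i + 1) k ω * genAge X S 0 k ω ∂P :=
    fun k => by simpa using hXS.integral_countInd_mul_genAge_pow_nonneg (i + 1) k 1
  have h := hasSum_of_affine_recursion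
    (a := fun k => ∫ ω, countInd X S (i + 1) k ω * genAge X S 0 k ω ^ 2 ∂P)
    (b := fun k => d * ∫ ω, countInd X S (i + 1) k ω ∂P + d' * ∫ ω, countInd X S i k ω ∂P
      + 2 * c * ∫ ω, countInd X S (i + 1) k ω * genAge X S 0 k ω ∂P)
    hq.2 (fun k => hXS.integral_countInd_mul_genAge_pow_nonneg (i + 1) k 2)
    (fun k => add_nonneg (add_nonneg (mul_nonneg hd0 (hnn _ k)) (mul_nonneg hd0' (hnn _ k)))
      (mul_nonneg (by positivity) (hnV k))) (fun k => ?_)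
    ((((hXS.hasSum_integral_countInd (i + 1)).mul_left d).add
      ((hXS.hasSum_integral_countInd i).mul_left d')).add
      ((hXS.hasSum_integral_countInd_mul_genAge i).mul_left (2 * c)))
  · convert h using 1
    rw [← add_mul, hcc]
    simp only [countInd_succ_zero, zero_mul, integral_zero, sub_sub_cancel,
      Nat.factorial]
    push_cast
    field_simp
    ring
  · have i1 := hXS.integrable_mul_mark (hm (i + 1) k) (hXS.integrable_countInd (i + 1) k)
      (measurable_fst_pow_mul_fail 2) (integrable_fst_pow_mul_fail hlam 2)
    have i2 := hXS.integrable_mul_mark (hm i k) (hXS.integrable_countInd i k)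
      (measurable_fst_pow_mul_succ 2) (integrable_fst_pow_mul_succ hlam 2)
    have i3 := hXS.integrable_mul_mark (hmV k)
      (hXS.integrable_countInd_mul (i + 1) k (hXS.integrable_genAge k))
      ((measurable_fst_pow_mul_fail 1).const_mul 2)
      ((integrable_fst_pow_mul_fail hlam 1).const_mul 2)
    have i4 := hXS.integrable_mul_mark (hmV2 k)
      (hXS.integrable_countInd_mul (i + 1) k (hXS.integrable_genAge_sq k)) measurable_fail
      (integrable_fail hlam)
    simp_rw [countInd_mul_genAge_sq_succ]
    refine (integral_add ((i1.add i2).add i3) i4).trans ?_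
    rw [integral_add' (i1.add i2) i3, integral_add' i1 i2,
      hXS.integral_mul_mark (hm (i + 1) k) (measurable_fst_pow_mul_fail 2),
      hXS.integral_mul_mark (hm i k) (measurable_fst_pow_mul_succ 2),
      hXS.integral_mul_mark (hmV k) ((measurable_fst_pow_mul_fail 1).const_mul 2),
      hXS.integral_mul_mark (hmV2 k) measurable_fail, integral_fail hν hlam, integral_const_mul]
    ring

/-- The trapezoid areas are integrable, with a common mean. -/
lemma IsInput.integral_trapezoidArea (hXS : IsInput P lam ν X S) (i : ℕ) :
    Integrable (trapezoidArea X S i) P ∧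
      ∫ ω, trapezoidArea X S i ω ∂P = 1 / (lam * laplace ν lam) ^ 2 := by
  have hν := hXS.service_nonneg
  have hlam := hXS.rate_pos
  have hp := laplace_pos hν hlam
  have hce := integral_fst_fail_add_snd_succ hν hlam
  set c := ∫ x, x.1 ^ 1 * (1 - succInd x) ∂(expMeasure lam).prod ν with hc
  set e := ∫ x, x.2 * succInd x ∂(expMeasure lam).prod ν with he
  have hmS : Measurable fun x : ℝ × ℝ => x.2 * succInd x := measurable_snd.mul measurable_succInd
  have hmV : ∀ k, Measurable[history X S k]
      fun ω => countInd X S (i + 1) k ω * genAge X S 0 k ω :=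
    fun k => (measurable_history_countInd _ k).mul (measurable_history_genAge 0 k)
  have hmV2 : ∀ k, Measurable[history X S k]
      fun ω => countInd X S (i + 1) k ω * genAge X S 0 k ω ^ 2 :=
    fun k => (measurable_history_countInd _ k).mul ((measurable_history_genAge 0 k).pow_const 2)
  have i1 := fun k => hXS.integrable_mul_mark (hmV2 k)
    (hXS.integrable_countInd_mul (i + 1) k (hXS.integrable_genAge_sq k))
    (measurable_succInd.div_const 2) ((integrable_succInd hlam).div_const 2)
  have i2 := fun k => hXS.integrable_mul_mark (hmV k)
    (hXS.integrable_countInd_mul (i + 1) k (hXS.integrable_genAge k)) hmS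
    (integrable_snd_mul_succ hν hlam)
  have hsplit : ∀ k ω, countInd X S (i + 1) k ω * succInd (mark X S k ω)
      * (genAge X S 0 k ω ^ 2 / 2 + genAge X S 0 k ω * S k ω)
      = countInd X S (i + 1) k ω * genAge X S 0 k ω ^ 2 * (succInd (mark X S k ω) / 2)
        + countInd X S (i + 1) k ω * genAge X S 0 k ω
          * ((mark X S k ω).2 * succInd (mark X S k ω)) := by
    intro k ω
    change _ = _ + _ * (S k ω * _)
    ring
  refine integral_eq_of_hasSum_of_nonneg (f := fun k ω => countInd X S (i + 1) k ω
    * succInd (mark X S k ω) * (genAge X S 0 k ω ^ 2 / 2 + genAge X S 0 k ω * S k ω))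
    (fun k => ?_) (fun k => ?_) ?_ ?_
  · simp_rw [hsplit]
    exact (i1 k).add (i2 k)
  · filter_upwards [hXS.ae_interarrival_pos, hXS.ae_service_nonneg] with ω hx hs
    have hV := genAge_nonneg (S := S) hx le_rfl k
    exact mul_nonneg (mul_nonneg (countInd_nonneg _ k) (succInd_nonneg _))
      (add_nonneg (by positivity) (mul_nonneg hV (hs k)))
  · have hint : ∀ k, ∫ ω, countInd X S (i + 1) k ω * succInd (mark X S k ω)
        * (genAge X S 0 k ω ^ 2 / 2 + genAge X S 0 k ω * S k ω) ∂P
        = (laplace ν lam / 2) * ∫ ω, countInd X S (i + 1) k ω * genAge X S 0 k ω ^ 2 ∂P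
          + e * ∫ ω, countInd X S (i + 1) k ω * genAge X S 0 k ω ∂P := by
      intro k
      simp_rw [hsplit]
      rw [integral_add (i1 k) (i2 k),
        hXS.integral_mul_mark (hmV2 k) (measurable_succInd.div_const 2),
        hXS.integral_mul_mark (hmV k) hmS, integral_div, integral_succInd hν hlam]
      ring
    simp_rw [hint]
    convert! ((hXS.hasSum_integral_countInd_mul_genAge_sq i).mul_left (laplace ν lam / 2)).add
      ((hXS.hasSum_integral_countInd_mul_genAge i).mul_left e) using 1
    -- The total is `1/(lam^2*p) + (c + e)/(lam*p^2)`; substituting `c + e = (1-p)/lam` leaves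
    -- `1/(lam*p)^2`.
    rw [← hc, eq_sub_of_add_eq hce]
    field_simp
    ring
  · filter_upwards [hXS.ae_tendsto_succCount_div] with ω hω
    exact hasSum_trapezoidArea (infinite_successful hp hω) i

end Trapezoid

end MG11

theorem mainTheorem5 {Ω : Type*} [MeasurableSpace Ω] (P : Measure Ω) [IsProbabilityMeasure P]
    (lam : ℝ) (ν : Measure ℝ) [IsProbabilityMeasure ν] (X S : ℕ → Ω → ℝ)
    (hXS : MG11.IsInput P lam ν X S) (a₀ : Ω → ℝ) (ha₀ : ∀ ω, 0 ≤ a₀ ω) :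
    ∃ lamE EQ : ℝ,
      (∀ᵐ ω ∂P, Tendsto (fun τ : ℝ => (MG11.numSuccess X S τ ω : ℝ) / τ) atTop (𝓝 lamE)) ∧
      lamE = lam * MG11.laplace ν lam ∧
      (∀ i, Integrable (MG11.trapezoidArea X S i) P ∧
        ∫ ω, MG11.trapezoidArea X S i ω ∂P = EQ) ∧
      (∀ᵐ ω ∂P,
        (∀ τ, 0 ≤ τ → IntervalIntegrable (MG11.age X S a₀ ω) volume 0 τ) ∧
        Tendsto (fun τ : ℝ => (1 / τ) * ∫ t in (0 : ℝ)..τ, MG11.age X S a₀ ω t)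
          atTop (𝓝 (lamE * EQ))) ∧
      lamE * EQ = 1 / (lam * MG11.laplace ν lam) := by
  have hlam := hXS.rate_pos
  have hp := MG11.laplace_pos hXS.service_nonneg hlam
  have heq : lam * MG11.laplace ν lam * (1 / (lam * MG11.laplace ν lam) ^ 2)
      = 1 / (lam * MG11.laplace ν lam) := by
    field_simp
  refine ⟨lam * MG11.laplace ν lam, 1 / (lam * MG11.laplace ν lam) ^ 2,
    hXS.ae_tendsto_numSuccess_div, rfl, hXS.integral_trapezoidArea, ?_, heq⟩
  rw [heq]
  filter_upwards [hXS.ae_service_nonneg, hXS.ae_tendsto_average_age ha₀] with ω hs h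
  exact ⟨fun τ _ => MG11.intervalIntegrable_age hs 0 τ, h⟩
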